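/- Let $L(sl_2)=\mathbb{C}[t,t^{-1}]\otimes sl_2(\mathbb{C})$ be the $sl_2$ loop algebra, with $x_k^{+}=t^k\otimes e$, $x_k^{-}=t^k\otimes f$, $h_k=t^k\otimes h$ ($k\in\mathbb{Z}$), so that $[h_j,x_k^{\pm}]=\pm 2x_{j+k}^{\pm}$, $[x_j^{+},x_k^{-}]=h_{j+k}$, $[h_j,h_k]=[x_j^{\pm},x_k^{\pm}]=0$. Write $X^{(n)}=X^n/n!$. For a collection $A=\{\alpha_1,\dots,\alpha_m\}$ of $m$ complex parameters (repetitions allowed) put $$x_m^{-}(A)=\sum_{k=0}^{m}(-1)^k\Big(\sum_{i_1<\dots<i_k}\alpha_{i_1}\cdots\alpha_{i_k}\Big)x_{m-k}^{-}.$$ Let $\Omega$ be a highest weight vector in a complex representation of $L(sl_2)$, i.e. $\Omega\neq 0$, $x_k^{+}\Omega=0$ and $h_k\Omega\in\mathbb{C}\Omega$ for all $k\in\mathbb{Z}$, and assume that the subrepresentation $V_\Omega$ generated by $\Omega$ is finite-dimensional. Then $h_0\Omega=r\Omega$ for an integer $r\ge 0$; for $0\le k\le r$ there are scalars $\lambda_k$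 with $(x_0^{+})^{(k)}(x_1^{-})^{(k)}\Omega=\lambda_k\Omega$; and the polynomial $P_\Omega(u)=\sum_{k=0}^{r}\lambda_k(-u)^k$ has degree $r$. Write $P_\Omega(u)=\prod_{k=1}^{s}(1-a_ku)^{m_k}$ with $a_1,\dots,a_s$ nonzero and pairwise distinct and $m_k\ge 1$; the $a_k$ are the evaluation parameters of $\Omega$, with multiplicities $m_k$. Assume that the evaluation parameters counted with multiplicity are distinct, i.e. $m_k=1$ for all $k$. Put $\boldsymbol a=\{a_1,\dots,a_s\}$ and $\rho_j(\boldsymbol a)=x_{s-1}^{-}(\boldsymbol a\setminus\{a_j\})$ for $1\le j\le s$. Then for every integer $n\ge 0$ the vectors $$\rho_{j_1}(\boldsymbol a)\cdots\rho_{j_n}(\boldsymbol a)\,\Omega,\qquad 1\le j_1<\cdots<j_n\le s,$$ form a basis of the sector $\{v\in V_\Omega : h_0v=(r-2n)v\}$, while the vectors $\rho_{j_1}(\boldsymbol a)\cdots\rho_{j_n}(\boldsymbol a)\,\Omega$ with $1\le j_1\le\cdots\le j_n\le s$ in which some index is repeated are all zero. -/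

import Mathlib

noncomputable section

namespace SlTwoLoop

open scoped TensorProduct
open LieAlgebra

/-- The Lie algebra `sl₂(ℂ)` of traceless `2 × 2` complex matrices. -/
abbrev SlTwo : Type := SpecialLinear.sl (Fin 2) ℂ

/-- The `sl₂` loop algebra `L(sl₂) = ℂ[t, t⁻¹] ⊗ sl₂(ℂ)`. -/
abbrev L : Type := loopAlgebra ℂ ℤ SlTwo

/-- The element `t ^ k ⊗ y` of the loop algebra. -/
def mode (k : ℤ) (y : SlTwo) : L := AddMonoidAlgebra.single k (1 : ℂ) ⊗ₜ[ℂ] y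

/-- `x_k⁺ = t ^ k ⊗ e`, with `e` the matrix unit `E₁₂`. -/
def xPos (k : ℤ) : L := mode k (SpecialLinear.single 0 1 zero_ne_one 1)

/-- `x_k⁻ = t ^ k ⊗ f`, with `f` the matrix unit `E₂₁`. -/
def xNeg (k : ℤ) : L := mode k (SpecialLinear.single 1 0 one_ne_zero 1)

/-- `h_k = t ^ k ⊗ (E₁₁ - E₂₂)`. -/
def hCartan (k : ℤ) : L := mode k (SpecialLinear.singleSubSingle 0 1 1)

/-- The generator with parameters `x_m⁻(A) = ∑_{k=0}^m (-1)^k e_k(A) x_{m-k}⁻`, for a collection `A`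
of `m` parameters (with repetitions allowed), `e_k` being the elementary symmetric function. -/
def xNegParam (A : Multiset ℂ) : L :=
  ∑ k ∈ Finset.range (Multiset.card A + 1),
    ((-1 : ℂ) ^ k * A.esymm k) • xNeg ((Multiset.card A : ℤ) - (k : ℤ))

/-- `ρ_j(a) = x_{s-1}⁻(a ∖ {a_j})`, for a family `a` of `s` parameters. -/
def rho {s : ℕ} (a : Fin s → ℂ) (j : Fin s) : L :=
  xNegParam ((Finset.univ.erase j).val.map a)

variable {V : Type*} [AddCommGroup V] [Module ℂ V] [LieRingModule L V] [LieModule ℂ L V]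

/-- A highest weight vector: nonzero, annihilated by all `x_k⁺`, and a simultaneous eigenvector of
all `h_k`. -/
structure IsHighestWeightVector (Ω : V) : Prop where
  ne_zero : Ω ≠ 0
  annihilated : ∀ k : ℤ, ⁅xPos k, Ω⁆ = 0
  eigenvector : ∀ k : ℤ, ∃ d : ℂ, ⁅hCartan k, Ω⁆ = d • Ω

/-- The representation `V_Ω` generated by `Ω`. -/
def generatedRep (Ω : V) : LieSubmodule ℂ L V := LieSubmodule.lieSpan ℂ L {Ω}

/-- The sector `h₀ = c` of `V_Ω`. -/
def sector (Ω : V) (c : ℂ) : Submodule ℂ V :=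
  (generatedRep Ω).toSubmodule ⊓ Module.End.eigenspace (LieModule.toEnd ℂ L V (hCartan 0)) c

variable (V) in
/-- The divided power `y^{(n)} = y ^ n / n!`, as an operator on the representation `V`. -/
def divPow (y : L) (n : ℕ) : Module.End ℂ V :=
  ((n.factorial : ℂ)⁻¹) • (LieModule.toEnd ℂ L V y) ^ n

open Polynomial in
/-- `P(u) = ∑_{k=0}^r λ_k (-u)^k`, where `(x₀⁺)^{(k)} (x₁⁻)^{(k)} Ω = λ_k Ω`. For `Ω ≠ 0` there is
at most one such `P`. -/
def IsDrinfeldPolynomial (Ω : V) (r : ℕ) (P : ℂ[X]) : Prop :=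
  ∃ lam : ℕ → ℂ,
    (∀ k ≤ r, divPow V (xPos 0) k (divPow V (xNeg 1) k Ω) = lam k • Ω) ∧
    P = ∑ k ∈ Finset.range (r + 1), C (lam k) * (-X) ^ k

open Polynomial in
/-- `a_1, …, a_s` are the evaluation parameters with multiplicities `m_1, …, m_s` attached to `P`:
they are distinct and nonzero, `m_k ≥ 1`, and `P(u) = ∏_k (1 - a_k u)^{m_k}`. -/
structure IsEvaluationParameters (P : ℂ[X]) {s : ℕ} (a : Fin s → ℂ) (m : Fin s → ℕ) : Prop where
  injective : Function.Injective a
  ne_zero : ∀ k, a k ≠ 0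
  mult_pos : ∀ k, 1 ≤ m k
  factorization : P = ∏ k, (1 - C (a k) * X) ^ m k

/-- The vector `ρ_{j_1}(a) ⋯ ρ_{j_n}(a) Ω`. -/
def rhoVector (Ω : V) {s n : ℕ} (a : Fin s → ℂ) (j : Fin n → Fin s) : V :=
  (List.ofFn fun t => LieModule.toEnd ℂ L V (rho a (j t))).prod Ω

end SlTwoLoop

end

/-!
The Laurent polynomials `p` such that `p ⊗ f` kills `Ω` form an ideal `I`, and `V_Ω` is a module
over `(ℂ[t, t⁻¹] / I) ⊗ sl₂`. If `p ⊗ h` acts on `Ω` by `Λ p`, commuting `x₀⁺` past the powers of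
`x₁⁻` yields Newton's identities between the `λ_k` and the `Λ (t ^ k)`, so that
`P_Ω = ∏ (1 - a_i u)` means `Λ f = ∑ f(a_i)` for all polynomials `f`.

An idempotent `p` modulo `I` makes `p ⊗ e`, `p ⊗ h`, `p ⊗ f` an `sl₂`-triple on `V_Ω` with highest
weight `Λ p`. If `Λ p = 0` then `p ∈ I`, hence every root of the generator of `I` is some `a_i`; if
`Λ p = 1` then `(p ⊗ f)² Ω = 0` and `(q p ⊗ f) Ω = Λ (q p) (p ⊗ f) Ω` for all `q`, hence these roots
are simple. Therefore `I` consists of the `p` vanishing at all the `a_i`, the quotient by `I` is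
`ℂ^s`, and the `ρ_j` are multiples of `ε_j ⊗ f` for its primitive idempotents `ε_j`. Since
`Λ ε_j = 1`, repeated factors give `0`, whereas products of distinct factors are nonzero; they are
joint eigenvectors of the `p ⊗ h` with different eigenvalues.
-/

noncomputable section

namespace SlTwoLoop

section SlTwoTriples

variable {K 𝔤 M : Type*} [Field K] [CharZero K] [LieRing 𝔤] [LieAlgebra K 𝔤]
  [AddCommGroup M] [Module K M] [LieRingModule 𝔤 M] [LieModule K 𝔤 M] [FiniteDimensional K M]
  {h e f : 𝔤}

open LieModule (toEnd)

lemma exists_pow_toEnd_e_eq_zero (t : IsSl2Triple h e f) {v : M} {μ : K} (hv : ⁅h, v⁆ = μ • v) :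
    ∃ n : ℕ, (toEnd K 𝔤 M e ^ n) v = 0 := by
  by_contra! hne
  have independent : LinearIndependent K fun n : ℕ => (toEnd K 𝔤 M e ^ n) v :=
    Module.End.eigenvectors_linearIndependent' (toEnd K 𝔤 M h) (fun n : ℕ => μ + 2 * n)
      (fun m n hmn => by simpa using hmn) _ fun n =>
        ⟨Module.End.mem_eigenspace_iff.2 (t.lie_h_pow_toEnd_e hv n), hne n⟩
  exact not_finite_iff_infinite.2 inferInstance independent.finite

lemma pow_toEnd_e_ne_zero (t : IsSl2Triple h e f) {r : ℕ}
    (hr : ∀ n : ℕ, (toEnd K 𝔤 M h).HasEigenvalue (r + 2 * n) → n = 0) {v : M} (hv : v ≠ 0)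
    (hweight : ⁅h, v⁆ = (-r : K) • v) : (toEnd K 𝔤 M e ^ r) v ≠ 0 := by
  have hweight' : ⁅-h, v⁆ = (r : K) • v := by rw [neg_lie, hweight, neg_smul, neg_neg]
  obtain ⟨n, hn, hn_succ⟩ := Nat.exists_not_and_succ_of_not_zero_of_exists
    (p := fun n => (toEnd K 𝔤 M f ^ n) v = 0) (by simpa using hv)
    (exists_pow_toEnd_e_eq_zero t.symm hweight')
  have primitive : t.symm.HasPrimitiveVectorWith ((toEnd K 𝔤 M f ^ n) v) ((r + 2 * n : ℕ) : K) :=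
    { ne_zero := hn
      lie_h := by push_cast; exact t.symm.lie_h_pow_toEnd_e hweight' n
      lie_e := by rw [IsSl2Triple.lie_e_pow_toEnd_e, hn_succ] }
  have lie_h := primitive.lie_h_pow_toEnd_f (r + 2 * n)
  obtain rfl : n = 0 := by
    refine hr n (Module.End.hasEigenvalue_of_hasEigenvector ⟨Module.End.mem_eigenspace_iff.2 ?_,
      primitive.pow_toEnd_f_ne_zero_of_eq_nat rfl le_rfl⟩)
    rw [neg_lie, neg_eq_iff_eq_neg, ← neg_smul] at lie_h
    refine lie_h.trans (congrArg (· • _) ?_)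
    push_cast
    ring
  simpa using primitive.pow_toEnd_f_ne_zero_of_eq_nat rfl le_rfl

end SlTwoTriples

lemma span_range_inf_eigenspace {K V ι : Type*} [Field K] [AddCommGroup V] [Module K V]
    (f : Module.End K V) {v : ι → V} {μ : ι → K} (hv : ∀ i, f (v i) = μ i • v i) (c : K) :
    Submodule.span K (Set.range v) ⊓ f.eigenspace c = Submodule.span K (v '' {i | μ i = c}) := by
  set A := v '' {i | μ i = c}
  set B := v '' {i | μ i ≠ c}
  have hA : Submodule.span K A ≤ f.eigenspace c := by
    rw [Submodule.span_le]
    rintro _ ⟨i, rfl, rfl⟩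
    exact Module.End.mem_eigenspace_iff.2 (hv i)
  have hB : Submodule.span K B ≤ ⨆ d, ⨆ (_ : d ≠ c), f.eigenspace d := by
    rw [Submodule.span_le]
    rintro _ ⟨i, hi, rfl⟩
    exact Submodule.mem_iSup_of_mem (μ i) (Submodule.mem_iSup_of_mem hi
      (Module.End.mem_eigenspace_iff.2 (hv i)))
  have disjoint : Submodule.span K B ⊓ f.eigenspace c = ⊥ :=
    ((f.eigenspaces_iSupIndep c).mono_right hB).symm.eq_bot
  have hrange : Set.range v = A ∪ B := by
    rw [← Set.image_union, ← Set.image_univ]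
    exact congrArg _ (Set.union_compl_self {i | μ i = c}).symm
  rw [hrange, Submodule.span_union, sup_inf_assoc_of_le _ hA, disjoint, sup_bot_eq]

section SymmetricFunctions

open Polynomial

lemma coeff_sum_C_mul_neg_X_pow {R : Type*} [CommRing R] (c : ℕ → R) (r n : ℕ) :
    (∑ k ∈ Finset.range (r + 1), C (c k) * (-X) ^ k : R[X]).coeff n =
      if n ≤ r then (-1) ^ n * c n else 0 := by
  have coeff_term (k : ℕ) :
      (C (c k) * (-X) ^ k : R[X]).coeff n = if n = k then (-1) ^ n * c n else 0 := by
    rw [neg_pow, ← C_1, ← C_neg, ← C_pow, coeff_C_mul, coeff_C_mul_X_pow]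
    split_ifs with h
    · rw [h, mul_comm]
    · exact mul_zero _
  simp only [finsetSum_coeff, coeff_term, Finset.sum_ite_eq, Finset.mem_range, Nat.lt_succ_iff]

variable {R ι : Type*} [CommRing R] [Fintype ι] (a : ι → R)

lemma coeff_prod_one_sub_C_mul_X (n : ℕ) :
    (∏ i, (1 - C (a i) * X) : R[X]).coeff n =
      (-1) ^ n * (Finset.univ.val.map a).esymm n := by
  have prod_eq : (∏ i, (1 - C (a i) * X) : R[X]) =
      ∑ k ∈ Finset.range (Fintype.card ι + 1),
        C ((Finset.univ.val.map a).esymm k) * (-X) ^ k := by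
    simp only [sub_eq_add_neg, ← mul_neg, Finset.prod_one_add, Finset.sum_powerset,
      Finset.esymm_map_val, map_sum, map_prod, Finset.sum_mul, Finset.card_univ]
    refine Finset.sum_congr rfl fun k _ => Finset.sum_congr rfl fun t ht => ?_
    rw [Finset.prod_mul_distrib, Finset.prod_const, (Finset.mem_powersetCard.1 ht).2]
  rw [prod_eq, coeff_sum_C_mul_neg_X_pow]
  split_ifs with h
  · rfl
  · rw [Finset.esymm_map_val, Finset.powersetCard_eq_empty.2 (not_le.1 h), Finset.sum_empty,
      mul_zero]

lemma natDegree_prod_one_sub_C_mul_X [IsDomain R] {a : ι → R} (ha : ∀ i, a i ≠ 0) :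
    (∏ i, (1 - C (a i) * X) : R[X]).natDegree = Fintype.card ι := by
  have natDegree_factor (i : ι) : (1 - C (a i) * X : R[X]).natDegree = 1 := by
    rw [natDegree_sub_eq_right_of_natDegree_lt] <;> simp [natDegree_C_mul_X _ (ha i)]
  rw [natDegree_prod _ _ fun i _ => ne_zero_of_natDegree_gt ((natDegree_factor i).ge),
    Finset.sum_congr rfl fun i _ => natDegree_factor i, Finset.sum_const, smul_eq_mul, mul_one,
    Finset.card_univ]

lemma add_one_mul_esymm_eq_sum (n : ℕ) :
    ((n : R) + 1) * (Finset.univ.val.map a).esymm (n + 1) =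
      ∑ j ∈ Finset.range (n + 1),
        (-1) ^ j * (∑ i, a i ^ (j + 1)) * (Finset.univ.val.map a).esymm (n - j) := by
  classical
  have aeval_psum (k : ℕ) : MvPolynomial.aeval a (MvPolynomial.psum ι R k) = ∑ i, a i ^ k := by
    simp [MvPolynomial.psum]
  have antidiagonal_eq : {b ∈ Finset.HasAntidiagonal.antidiagonal (n + 1) | b.1 < n + 1} =
      (Finset.range (n + 1)).image fun j => (n - j, j + 1) := by
    ext ⟨i, j⟩
    simp only [Finset.mem_filter, Finset.HasAntidiagonal.mem_antidiagonal, Finset.mem_image,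
      Finset.mem_range, Prod.mk.injEq]
    exact ⟨fun h => ⟨j - 1, by omega⟩, by omega⟩
  have newton := congrArg (MvPolynomial.aeval a) (MvPolynomial.mul_esymm_eq_sum ι R (n + 1))
  rw [antidiagonal_eq, Finset.sum_image (by intro i _ j _; simp)] at newton
  simp only [map_mul, map_pow, map_neg, map_one, map_sum, map_natCast, aeval_psum,
    MvPolynomial.aeval_esymm_eq_multiset_esymm] at newton
  rw [← Nat.cast_succ, newton, Finset.mul_sum]
  refine Finset.sum_congr rfl fun j hj => ?_
  obtain ⟨i, rfl⟩ := Nat.exists_eq_add_of_le' (Nat.lt_succ_iff.1 (Finset.mem_range.1 hj))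
  have sign_eq : (-1 : R) ^ (i + j + 1 + 1) * (-1) ^ i = (-1) ^ j := by
    rw [← pow_add, show i + j + 1 + 1 + i = 2 * (i + 1) + j by ring, pow_add, pow_mul,
      neg_one_sq, one_pow, one_mul]
  rw [Nat.add_sub_cancel, ← sign_eq]
  ring

end SymmetricFunctions

section PolynomialIdempotents

open Polynomial

lemma exists_dvd_mul_self_sub_self {K : Type*} [Field K] {g : K[X]} (hg : g ≠ 0) {b : K}
    (hb : g.IsRoot b) :
    ∃ p : K[X], g ∣ p * p - p ∧ p.eval b = 1 ∧ ∀ c ≠ b, g.IsRoot c → p.eval c = 0 := by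
  obtain ⟨g', hg_eq, hdvd⟩ := exists_eq_pow_rootMultiplicity_mul_and_not_dvd g hg b
  have pos : g.rootMultiplicity b ≠ 0 := ((rootMultiplicity_pos hg).2 hb).ne'
  generalize g.rootMultiplicity b = m at hg_eq pos
  obtain ⟨u, w, huw⟩ : IsCoprime ((X - C b) ^ m) g' :=
    (((irreducible_X_sub_C b).coprime_iff_not_dvd).2 hdvd).pow_left
  refine ⟨w * g', ⟨-(u * w), ?_⟩, ?_, fun c hcb hc => ?_⟩
  · rw [hg_eq]
    linear_combination (w * g') * huw
  · simpa [pos] using congrArg (eval b) huw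
  · rw [hg_eq, IsRoot.def, eval_mul, eval_pow, eval_sub, eval_X, eval_C] at hc
    rw [eval_mul, (mul_eq_zero.1 hc).resolve_left (pow_ne_zero m (sub_ne_zero.2 hcb)), mul_zero]

end PolynomialIdempotents

section Nodal

open Polynomial Lagrange

variable {R ι : Type*} [CommRing R] [Fintype ι] [DecidableEq ι] {a : ι → R}

lemma eval_nodal_erase_of_ne {i j : ι} (hij : i ≠ j) :
    (nodal (Finset.univ.erase j) a).eval (a i) = 0 :=
  eval_nodal_at_node (Finset.mem_erase.2 ⟨hij, Finset.mem_univ i⟩)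

lemma eval_nodal_erase_self_ne_zero [IsDomain R] (ha : Function.Injective a) (j : ι) :
    (nodal (Finset.univ.erase j) a).eval (a j) ≠ 0 :=
  eval_nodal_not_at_node fun _ hi => ha.ne (Finset.ne_of_mem_erase hi).symm

lemma sum_eval_mul_nodal_erase (f : R[X]) (j : ι) :
    ∑ i, (f * nodal (Finset.univ.erase j) a).eval (a i) =
      f.eval (a j) * (nodal (Finset.univ.erase j) a).eval (a j) := by
  rw [Fintype.sum_eq_single j, eval_mul]
  intro i hij
  rw [eval_mul, eval_nodal_erase_of_ne hij, mul_zero]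

end Nodal

open scoped TensorProduct LaurentPolynomial
open LieAlgebra LaurentPolynomial
open LieModule (toEnd)

/-- The element `p ⊗ e` of the loop algebra, so that `xPos k = pos (T k)`. -/
def pos : ℂ[T;T⁻¹] →ₗ[ℂ] L :=
  (TensorProduct.mk ℂ ℂ[T;T⁻¹] SlTwo).flip (SpecialLinear.single 0 1 zero_ne_one 1)

/-- The element `p ⊗ f` of the loop algebra, so that `xNeg k = neg (T k)`. -/
def neg : ℂ[T;T⁻¹] →ₗ[ℂ] L :=
  (TensorProduct.mk ℂ ℂ[T;T⁻¹] SlTwo).flip (SpecialLinear.single 1 0 one_ne_zero 1)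

/-- The element `p ⊗ h` of the loop algebra, so that `hCartan k = cartan (T k)`. -/
def cartan : ℂ[T;T⁻¹] →ₗ[ℂ] L :=
  (TensorProduct.mk ℂ ℂ[T;T⁻¹] SlTwo).flip (SpecialLinear.singleSubSingle 0 1 1)

lemma pos_T (k : ℤ) : pos (T k) = xPos k := rfl

lemma neg_T (k : ℤ) : neg (T k) = xNeg k := rfl

lemma cartan_T (k : ℤ) : cartan (T k) = hCartan k := rfl

lemma isSl2Triple_slTwo : IsSl2Triple (SpecialLinear.singleSubSingle 0 1 1 : SlTwo)
    (SpecialLinear.single 0 1 zero_ne_one 1) (SpecialLinear.single 1 0 one_ne_zero 1) where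
  h_ne_zero h := by simpa using congrArg (fun y : SlTwo => y.val 0 0) h
  lie_e_f := by
    ext i j
    fin_cases i <;> fin_cases j <;> simp [LieRing.of_associative_ring_bracket]
  lie_h_e_nsmul := by
    ext i j
    fin_cases i <;> fin_cases j <;>
      simp [LieRing.of_associative_ring_bracket, Matrix.mul_apply, Matrix.single_apply,
        one_add_one_eq_two]
  lie_h_f_nsmul := by
    ext i j
    fin_cases i <;> fin_cases j <;>
      simp [LieRing.of_associative_ring_bracket, Matrix.mul_apply, Matrix.single_apply]
    norm_num

lemma lie_pos_neg (p q : ℂ[T;T⁻¹]) : ⁅pos p, neg q⁆ = cartan (p * q) := by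
  change ⁅p ⊗ₜ[ℂ] _, q ⊗ₜ[ℂ] _⁆ = (p * q) ⊗ₜ[ℂ] _
  rw [ExtendScalars.bracket_tmul, isSl2Triple_slTwo.lie_e_f]

lemma lie_cartan_pos (p q : ℂ[T;T⁻¹]) : ⁅cartan p, pos q⁆ = (2 : ℂ) • pos (p * q) := by
  change ⁅p ⊗ₜ[ℂ] _, q ⊗ₜ[ℂ] _⁆ = (2 : ℂ) • ((p * q) ⊗ₜ[ℂ] _)
  rw [ExtendScalars.bracket_tmul, isSl2Triple_slTwo.lie_h_e_smul ℂ, TensorProduct.tmul_smul]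

lemma lie_cartan_neg (p q : ℂ[T;T⁻¹]) : ⁅cartan p, neg q⁆ = (-2 : ℂ) • neg (p * q) := by
  change ⁅p ⊗ₜ[ℂ] _, q ⊗ₜ[ℂ] _⁆ = (-2 : ℂ) • ((p * q) ⊗ₜ[ℂ] _)
  rw [ExtendScalars.bracket_tmul, isSl2Triple_slTwo.lie_lie_smul_f ℂ, ← neg_smul,
    TensorProduct.tmul_smul]

lemma lie_pos_pos (p q : ℂ[T;T⁻¹]) : ⁅pos p, pos q⁆ = 0 := by
  change ⁅p ⊗ₜ[ℂ] _, q ⊗ₜ[ℂ] _⁆ = _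
  rw [ExtendScalars.bracket_tmul, lie_self, TensorProduct.tmul_zero]

lemma lie_neg_neg (p q : ℂ[T;T⁻¹]) : ⁅neg p, neg q⁆ = 0 := by
  change ⁅p ⊗ₜ[ℂ] _, q ⊗ₜ[ℂ] _⁆ = _
  rw [ExtendScalars.bracket_tmul, lie_self, TensorProduct.tmul_zero]

lemma slTwo_eq (y : SlTwo) :
    y = y.val 0 1 • SpecialLinear.single 0 1 zero_ne_one 1
      + y.val 1 0 • SpecialLinear.single 1 0 one_ne_zero 1
      + y.val 0 0 • SpecialLinear.singleSubSingle 0 1 1 := by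
  have trace_eq : y.val 0 0 + y.val 1 1 = 0 := (Matrix.trace_fin_two y.val).symm.trans y.2
  ext i j
  fin_cases i <;> fin_cases j <;> simp
  linear_combination trace_eq

lemma exists_eq_pos_add_neg_add_cartan (x : L) :
    ∃ p q r : ℂ[T;T⁻¹], x = pos p + neg q + cartan r := by
  induction x using TensorProduct.induction_on with
  | zero => exact ⟨0, 0, 0, by simp only [map_zero, add_zero]⟩
  | tmul p y =>
    refine ⟨y.val 0 1 • p, y.val 1 0 • p, y.val 0 0 • p, ?_⟩
    conv_lhs => rw [slTwo_eq y]
    simp only [TensorProduct.tmul_add, TensorProduct.tmul_smul, map_smul]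
    rfl
  | add x y hx hy =>
    obtain ⟨p, q, r, rfl⟩ := hx
    obtain ⟨p', q', r', rfl⟩ := hy
    refine ⟨p + p', q + q', r + r', ?_⟩
    simp only [map_add]
    abel

section Action

variable {V : Type*} [AddCommGroup V] [LieRingModule L V]

lemma pos_neg_lie (p q : ℂ[T;T⁻¹]) (v : V) :
    ⁅pos p, ⁅neg q, v⁆⁆ = ⁅cartan (p * q), v⁆ + ⁅neg q, ⁅pos p, v⁆⁆ := by
  rw [leibniz_lie, lie_pos_neg]

lemma neg_neg_lie (p q : ℂ[T;T⁻¹]) (v : V) :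
    ⁅neg p, ⁅neg q, v⁆⁆ = ⁅neg q, ⁅neg p, v⁆⁆ := by
  rw [leibniz_lie, lie_neg_neg, zero_lie, zero_add]

variable [Module ℂ V] [LieModule ℂ L V]

-- `rw [smul_lie]` fails to unify the `ℂ`-module structures of `L` as a Lie algebra and as a tensor
-- product.
lemma loop_smul_lie (c : ℂ) (x : L) (v : V) : ⁅c • x, v⁆ = c • ⁅x, v⁆ := smul_lie c x v

lemma cartan_neg_lie (p q : ℂ[T;T⁻¹]) (v : V) :
    ⁅cartan p, ⁅neg q, v⁆⁆ = (-2 : ℂ) • ⁅neg (p * q), v⁆ + ⁅neg q, ⁅cartan p, v⁆⁆ := by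
  rw [leibniz_lie, lie_cartan_neg, loop_smul_lie]

end Action

section HighestWeight

variable {V : Type*} [AddCommGroup V] [LieRingModule L V]

/-- The vector `(p₁ ⊗ f) ⋯ (pₙ ⊗ f) Ω`, for a list `p₁, …, pₙ` of Laurent polynomials. -/
def lowered (Ω : V) (l : List ℂ[T;T⁻¹]) : V := l.foldr (fun p v => ⁅neg p, v⁆) Ω

lemma lowered_cons (Ω : V) (p : ℂ[T;T⁻¹]) (l : List ℂ[T;T⁻¹]) :
    lowered Ω (p :: l) = ⁅neg p, lowered Ω l⁆ := rfl

variable {Ω : V}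

lemma lowered_eq_of_perm {l l' : List ℂ[T;T⁻¹]} (hl : l.Perm l') : lowered Ω l = lowered Ω l' := by
  have : LeftCommutative fun (p : ℂ[T;T⁻¹]) (v : V) => ⁅neg p, v⁆ := ⟨fun p q => neg_neg_lie p q⟩
  exact hl.foldr_eq Ω

variable [Module ℂ V]

lemma mem_generatedRep (Ω : V) : Ω ∈ generatedRep Ω := LieSubmodule.subset_lieSpan rfl

lemma lowered_mem_generatedRep (l : List ℂ[T;T⁻¹]) : lowered Ω l ∈ generatedRep Ω := by
  induction l with
  | nil => exact mem_generatedRep Ω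
  | cons p l ih => exact (generatedRep Ω).lie_mem ih

/-- `Ω` is a highest weight vector on which `p ⊗ h` acts by the scalar `Λ p`: the eigenvalues of
all the `h_k` are recorded as one linear functional on Laurent polynomials. -/
structure HasLoopWeight (Ω : V) (Λ : ℂ[T;T⁻¹] →ₗ[ℂ] ℂ) : Prop where
  ne_zero : Ω ≠ 0
  pos_lie : ∀ p, ⁅pos p, Ω⁆ = 0
  cartan_lie : ∀ p, ⁅cartan p, Ω⁆ = Λ p • Ω

variable [LieModule ℂ L V] {Λ : ℂ[T;T⁻¹] →ₗ[ℂ] ℂ}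

lemma IsHighestWeightVector.exists_hasLoopWeight (hΩ : IsHighestWeightVector Ω) :
    ∃ Λ, HasLoopWeight Ω Λ := by
  have exists_scalar (p : ℂ[T;T⁻¹]) : ∃ c : ℂ, ⁅cartan p, Ω⁆ = c • Ω := by
    induction p using LaurentPolynomial.induction_on' with
    | add p q hp hq =>
      obtain ⟨c, hc⟩ := hp
      obtain ⟨d, hd⟩ := hq
      exact ⟨c + d, by rw [map_add, add_lie, hc, hd, add_smul]⟩
    | C_mul_T n a =>
      obtain ⟨c, hc⟩ := hΩ.eigenvector n
      exact ⟨a * c, by rw [← smul_eq_C_mul, map_smul, loop_smul_lie, cartan_T, hc, mul_smul]⟩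
  choose Λ hΛ using exists_scalar
  have smul_injective := smul_left_injective ℂ hΩ.ne_zero
  refine ⟨⟨⟨Λ, fun p q => smul_injective ?_⟩, fun a p => smul_injective ?_⟩, hΩ.ne_zero,
    fun p => ?_, hΛ⟩
  · simp only [add_smul, ← hΛ, map_add, add_lie]
  · simp only [RingHom.id_apply, smul_eq_mul, mul_smul, ← hΛ, map_smul, loop_smul_lie]
  · induction p using LaurentPolynomial.induction_on' with
    | add p q hp hq => rw [map_add, add_lie, hp, hq, add_zero]
    | C_mul_T n a =>
      rw [← smul_eq_C_mul, map_smul, loop_smul_lie, pos_T, hΩ.annihilated, smul_zero]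

lemma map_toEnd_span_lowered_le {x : L} {N : Submodule ℂ V} (h : ∀ l, ⁅x, lowered Ω l⁆ ∈ N) :
    (Submodule.span ℂ (Set.range (lowered Ω))).map (toEnd ℂ L V x) ≤ N := by
  rw [Submodule.map_span_le]
  rintro _ ⟨l, rfl⟩
  exact h l

lemma neg_lie_mem_span_lowered (p : ℂ[T;T⁻¹]) {v : V}
    (hv : v ∈ Submodule.span ℂ (Set.range (lowered Ω))) :
    ⁅neg p, v⁆ ∈ Submodule.span ℂ (Set.range (lowered Ω)) := by
  refine map_toEnd_span_lowered_le (fun l => ?_) (Submodule.mem_map_of_mem hv)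
  exact Submodule.subset_span ⟨p :: l, rfl⟩

namespace HasLoopWeight

lemma cartan_lie_lowered_mem (h : HasLoopWeight Ω Λ) (p : ℂ[T;T⁻¹]) (l : List ℂ[T;T⁻¹]) :
    ⁅cartan p, lowered Ω l⁆ ∈ Submodule.span ℂ (Set.range (lowered Ω)) := by
  induction l with
  | nil =>
    exact (h.cartan_lie p).symm ▸ Submodule.smul_mem _ _ (Submodule.subset_span ⟨[], rfl⟩)
  | cons q l ih =>
    rw [lowered_cons, cartan_neg_lie]
    exact add_mem (Submodule.smul_mem _ _ (Submodule.subset_span ⟨p * q :: l, rfl⟩))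
      (neg_lie_mem_span_lowered q ih)

lemma pos_lie_lowered_mem (h : HasLoopWeight Ω Λ) (p : ℂ[T;T⁻¹]) (l : List ℂ[T;T⁻¹]) :
    ⁅pos p, lowered Ω l⁆ ∈ Submodule.span ℂ (Set.range (lowered Ω)) := by
  induction l with
  | nil => exact (h.pos_lie p).symm ▸ zero_mem _
  | cons q l ih =>
    rw [lowered_cons, pos_neg_lie]
    exact add_mem (h.cartan_lie_lowered_mem _ l) (neg_lie_mem_span_lowered q ih)

lemma generatedRep_eq_span (h : HasLoopWeight Ω Λ) :
    (generatedRep Ω).toSubmodule = Submodule.span ℂ (Set.range (lowered Ω)) := by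
  apply le_antisymm
  · let N : LieSubmodule ℂ L V :=
      { Submodule.span ℂ (Set.range (lowered Ω)) with
        lie_mem := by
          intro x v hv
          obtain ⟨p, q, r, rfl⟩ := exists_eq_pos_add_neg_add_cartan x
          refine map_toEnd_span_lowered_le (fun l => ?_) (Submodule.mem_map_of_mem hv)
          rw [add_lie, add_lie]
          exact add_mem (add_mem (h.pos_lie_lowered_mem p l)
            (Submodule.subset_span ⟨q :: l, rfl⟩)) (h.cartan_lie_lowered_mem r l) }
    have hN : generatedRep Ω ≤ N :=
      LieSubmodule.lieSpan_le.2 (Set.singleton_subset_iff.2 (Submodule.subset_span ⟨[], rfl⟩))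
    exact hN
  · rw [Submodule.span_le]
    rintro _ ⟨l, rfl⟩
    exact lowered_mem_generatedRep l

lemma generatedRep_le (h : HasLoopWeight Ω Λ) {N : Submodule ℂ V} (hΩ : Ω ∈ N)
    (hN : ∀ p, ∀ v ∈ N, ⁅neg p, v⁆ ∈ N) : (generatedRep Ω).toSubmodule ≤ N := by
  rw [h.generatedRep_eq_span, Submodule.span_le]
  rintro _ ⟨l, rfl⟩
  induction l with
  | nil => exact hΩ
  | cons p l ih => exact hN p _ ih

lemma cartan_one_lie_lowered (h : HasLoopWeight Ω Λ) (l : List ℂ[T;T⁻¹]) :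
    ⁅cartan 1, lowered Ω l⁆ = (Λ 1 - 2 * l.length) • lowered Ω l := by
  induction l with
  | nil => simpa [lowered] using h.cartan_lie 1
  | cons q l ih =>
    rw [lowered_cons, cartan_neg_lie, ih, one_mul, lie_smul, ← add_smul, List.length_cons]
    push_cast
    ring_nf

lemma exists_eq_of_hasEigenvalue (h : HasLoopWeight Ω Λ) {c : ℂ}
    (hc : (toEnd ℂ L (generatedRep Ω) (cartan 1)).HasEigenvalue c) :
    ∃ n : ℕ, c = Λ 1 - 2 * n := by
  obtain ⟨⟨v, hvW⟩, hv⟩ := hc.exists_hasEigenvector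
  have hv_eigen : v ∈ Module.End.eigenspace (toEnd ℂ L V (cartan 1)) c :=
    Module.End.mem_eigenspace_iff.2 (congrArg Subtype.val hv.apply_eq_smul)
  by_contra! hne
  have hmem : v ∈ Submodule.span ℂ (Set.range (lowered Ω)) ⊓
      Module.End.eigenspace (toEnd ℂ L V (cartan 1)) c :=
    ⟨h.generatedRep_eq_span ▸ hvW, hv_eigen⟩
  rw [span_range_inf_eigenspace _ h.cartan_one_lie_lowered,
    Set.eq_empty_of_forall_notMem (s := {l : List ℂ[T;T⁻¹] | _}) fun l hl => hne l.length hl.symm,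
    Set.image_empty, Submodule.span_empty, Submodule.mem_bot] at hmem
  exact hv.2 (Subtype.ext hmem)

/-- The ideal of those `p` for which `p ⊗ f` annihilates the highest weight vector. The whole of
`p ⊗ sl₂` then annihilates the representation, so that it is a module over `(ℂ[t, t⁻¹] / I) ⊗ sl₂`
for this ideal `I`. -/
def annihilator (h : HasLoopWeight Ω Λ) : Ideal ℂ[T;T⁻¹] where
  carrier := {p | ⁅neg p, Ω⁆ = 0}
  add_mem' {p q} (hp : _ = _) (hq : _ = _) := by
    rw [Set.mem_ofPred_eq, map_add, add_lie, hp, hq, add_zero]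
  zero_mem' := by rw [Set.mem_ofPred_eq, map_zero, zero_lie]
  smul_mem' q p (hp : _ = _) := by
    have key := cartan_neg_lie q p Ω
    rw [hp, lie_zero, h.cartan_lie, lie_smul, hp, smul_zero, add_zero] at key
    exact (smul_eq_zero_iff_right (by norm_num)).1 key.symm

variable {p q : ℂ[T;T⁻¹]}

lemma mem_annihilator (h : HasLoopWeight Ω Λ) : p ∈ h.annihilator ↔ ⁅neg p, Ω⁆ = 0 := Iff.rfl

lemma apply_eq_zero_of_mem_annihilator (h : HasLoopWeight Ω Λ) (hp : p ∈ h.annihilator) :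
    Λ p = 0 := by
  have key := pos_neg_lie 1 p Ω
  rw [h.mem_annihilator.1 hp, h.pos_lie, lie_zero, lie_zero, add_zero, one_mul,
    h.cartan_lie] at key
  exact (smul_eq_zero_iff_left h.ne_zero).1 key.symm

lemma neg_lie_eq_zero (h : HasLoopWeight Ω Λ) (hp : p ∈ h.annihilator) {v : V}
    (hv : v ∈ generatedRep Ω) : ⁅neg p, v⁆ = 0 := by
  refine h.generatedRep_le (N := LinearMap.ker (toEnd ℂ L V (neg p))) hp (fun q v hv => ?_) hv
  exact (neg_neg_lie p q v).trans ((congrArg _ hv).trans (lie_zero _))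

lemma cartan_lie_eq_zero (h : HasLoopWeight Ω Λ) (hp : p ∈ h.annihilator) {v : V}
    (hv : v ∈ generatedRep Ω) : ⁅cartan p, v⁆ = 0 := by
  rw [← one_mul p, ← lie_pos_neg, lie_lie, h.neg_lie_eq_zero hp hv, lie_zero,
    h.neg_lie_eq_zero hp ((generatedRep Ω).lie_mem hv), sub_zero]

lemma pos_lie_eq_zero (h : HasLoopWeight Ω Λ) (hp : p ∈ h.annihilator) {v : V}
    (hv : v ∈ generatedRep Ω) : ⁅pos p, v⁆ = 0 := by
  have key : ⁅(2 : ℂ) • pos p, v⁆ = 0 := by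
    rw [← mul_one p, ← lie_cartan_pos, lie_lie, h.cartan_lie_eq_zero hp hv, lie_zero,
      h.cartan_lie_eq_zero hp ((generatedRep Ω).lie_mem hv), sub_zero]
  rw [loop_smul_lie] at key
  exact (smul_eq_zero_iff_right two_ne_zero).1 key

lemma pos_lie_congr (h : HasLoopWeight Ω Λ) (hpq : p - q ∈ h.annihilator) {v : V}
    (hv : v ∈ generatedRep Ω) : ⁅pos p, v⁆ = ⁅pos q, v⁆ := by
  rw [← sub_eq_zero, ← sub_lie, ← map_sub]
  exact h.pos_lie_eq_zero hpq hv

lemma neg_lie_congr (h : HasLoopWeight Ω Λ) (hpq : p - q ∈ h.annihilator) {v : V}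
    (hv : v ∈ generatedRep Ω) : ⁅neg p, v⁆ = ⁅neg q, v⁆ := by
  rw [← sub_eq_zero, ← sub_lie, ← map_sub]
  exact h.neg_lie_eq_zero hpq hv

attribute [local instance] LieRing.ofAssociativeRing

lemma isSl2Triple_toEnd (h : HasLoopWeight Ω Λ) (hp : p * q * p - p ∈ h.annihilator)
    (hq : p * q * q - q ∈ h.annihilator)
    (hne : toEnd ℂ L (generatedRep Ω) (cartan (p * q)) ≠ 0) :
    IsSl2Triple (toEnd ℂ L (generatedRep Ω) (cartan (p * q)))
      (toEnd ℂ L (generatedRep Ω) (pos q)) (toEnd ℂ L (generatedRep Ω) (neg p)) where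
  h_ne_zero := hne
  lie_e_f := by rw [← LieHom.map_lie, lie_pos_neg, mul_comm]
  lie_h_e_nsmul := by
    ext v
    rw [← LieHom.map_lie, lie_cartan_pos, ← Nat.cast_smul_eq_nsmul ℂ]
    exact (loop_smul_lie _ _ _).trans (congrArg _ (h.pos_lie_congr hq v.2))
  lie_h_f_nsmul := by
    ext v
    rw [← LieHom.map_lie, lie_cartan_neg, ← Nat.cast_smul_eq_nsmul ℂ, ← neg_smul]
    exact (loop_smul_lie _ _ _).trans (congrArg _ (h.neg_lie_congr hp v.2))

lemma exists_nat_pow_neg [FiniteDimensional ℂ (generatedRep Ω)] (h : HasLoopWeight Ω Λ)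
    (hp : p * q * p - p ∈ h.annihilator) (hq : p * q * q - q ∈ h.annihilator) :
    ∃ n : ℕ, Λ (p * q) = n ∧ (toEnd ℂ L V (neg p) ^ n) Ω ≠ 0 ∧
      (toEnd ℂ L V (neg p) ^ (n + 1)) Ω = 0 := by
  let Ω' : generatedRep Ω := ⟨Ω, mem_generatedRep Ω⟩
  by_cases hzero : toEnd ℂ L (generatedRep Ω) (cartan (p * q)) = 0
  · have cartan_zero (v : generatedRep Ω) : ⁅cartan (p * q), (v : V)⁆ = 0 :=
      congrArg Subtype.val (LinearMap.congr_fun hzero v)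
    refine ⟨0, ?_, h.ne_zero, ?_⟩
    · rw [Nat.cast_zero, ← smul_eq_zero_iff_left h.ne_zero, ← h.cartan_lie]
      exact cartan_zero Ω'
    · have key := cartan_neg_lie (p * q) p Ω
      rw [cartan_zero Ω', lie_zero, add_zero, h.neg_lie_congr hp Ω'.2] at key
      simpa [Ω'] using (cartan_zero ⁅neg p, Ω'⁆).symm.trans key
  · have primitive : (h.isSl2Triple_toEnd hp hq hzero).HasPrimitiveVectorWith Ω' (Λ (p * q)) :=
      { ne_zero := fun hΩ => h.ne_zero (congrArg Subtype.val hΩ)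
        lie_h := Subtype.ext (h.cartan_lie _)
        lie_e := Subtype.ext (h.pos_lie _) }
    obtain ⟨n, hn⟩ := primitive.exists_nat
    have ne_zero := primitive.pow_toEnd_f_ne_zero_of_eq_nat hn le_rfl
    have eq_zero := primitive.pow_toEnd_f_eq_zero_of_eq_nat hn
    rw [LieModule.toEnd_module_end, LieHom.id_apply, ← ZeroMemClass.coe_eq_zero,
      LieSubmodule.coe_toEnd_pow] at eq_zero
    rw [LieModule.toEnd_module_end, LieHom.id_apply, Ne, ← ZeroMemClass.coe_eq_zero,
      LieSubmodule.coe_toEnd_pow] at ne_zero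
    exact ⟨n, hn, ne_zero, eq_zero⟩

end HasLoopWeight

end HighestWeight

section DividedPowers

variable {V : Type*} [AddCommGroup V] [Module ℂ V] [LieRingModule L V] [LieModule ℂ L V]

lemma divPow_zero (x : L) (v : V) : divPow V x 0 v = v := by
  simp [divPow]

lemma divPow_one (x : L) (v : V) : divPow V x 1 v = ⁅x, v⁆ := by
  simp [divPow]

lemma lie_divPow (x : L) (n : ℕ) (v : V) :
    ⁅x, divPow V x n v⁆ = ((n : ℂ) + 1) • divPow V x (n + 1) v := by
  have hn : ((n : ℂ) + 1) ≠ 0 := Nat.cast_add_one_ne_zero n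
  simp only [divPow, LinearMap.smul_apply, lie_smul, smul_smul, pow_succ', Module.End.mul_apply,
    LieModule.toEnd_apply_apply, Nat.factorial_succ, Nat.cast_mul, Nat.cast_add, Nat.cast_one,
    mul_inv, mul_inv_cancel_left₀ hn]

variable {x y z w : L}

lemma divPow_lie_of_commute (hxw : ⁅x, w⁆ = 0) (n : ℕ) (v : V) :
    divPow V x n ⁅w, v⁆ = ⁅w, divPow V x n v⁆ := by
  induction n with
  | zero => rw [divPow_zero, divPow_zero]
  | succ n ih =>
    apply smul_right_injective V (Nat.cast_add_one_ne_zero n : (n : ℂ) + 1 ≠ 0)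
    simp only
    rw [← lie_divPow, ih, leibniz_lie, hxw, zero_lie, zero_add, lie_divPow, lie_smul]

lemma divPow_succ_lie (hxz : ⁅x, z⁆ = w) (hxw : ⁅x, w⁆ = 0) (n : ℕ) (v : V) :
    divPow V x (n + 1) ⁅z, v⁆ = ⁅z, divPow V x (n + 1) v⁆ + ⁅w, divPow V x n v⁆ := by
  induction n with
  | zero => rw [divPow_zero, divPow_one, divPow_one, leibniz_lie, hxz, add_comm]
  | succ n ih =>
    apply smul_right_injective V (Nat.cast_add_one_ne_zero (n + 1) : ((n + 1 : ℕ) : ℂ) + 1 ≠ 0)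
    simp only
    rw [← lie_divPow, ih, lie_add, leibniz_lie x z, leibniz_lie x w, hxz, hxw, zero_lie, zero_add,
      lie_divPow, lie_divPow, lie_smul, lie_smul]
    push_cast
    module

lemma divPow_add_two_lie (hxy : ⁅x, y⁆ = z) (hxz : ⁅x, z⁆ = (-2 : ℂ) • w) (hxw : ⁅x, w⁆ = 0)
    (n : ℕ) (v : V) :
    divPow V x (n + 2) ⁅y, v⁆ =
      ⁅y, divPow V x (n + 2) v⁆ + ⁅z, divPow V x (n + 1) v⁆ - ⁅w, divPow V x n v⁆ := by
  have lie_lie (v : V) : ⁅x, ⁅z, v⁆⁆ = (-2 : ℂ) • ⁅w, v⁆ + ⁅z, ⁅x, v⁆⁆ := by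
    rw [leibniz_lie, hxz, loop_smul_lie]
  induction n with
  | zero =>
    apply smul_right_injective V (Nat.cast_add_one_ne_zero 1 : ((1 : ℕ) : ℂ) + 1 ≠ 0)
    simp only [smul_add, smul_sub, ← lie_smul, zero_add]
    rw [← lie_divPow, ← lie_divPow, divPow_one, divPow_one, divPow_zero, leibniz_lie x y, hxy,
      lie_add, lie_lie, leibniz_lie x y, hxy, lie_smul, lie_smul]
    push_cast
    module
  | succ n ih =>
    apply smul_right_injective V (Nat.cast_add_one_ne_zero (n + 2) : ((n + 2 : ℕ) : ℂ) + 1 ≠ 0)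
    simp only
    rw [← lie_divPow, ih, lie_sub, lie_add, leibniz_lie x y, lie_lie, leibniz_lie x w, hxy, hxw,
      zero_lie, zero_add, lie_divPow, lie_divPow, lie_divPow, lie_smul, lie_smul, lie_smul]
    push_cast
    module

lemma divPow_pos_one_neg_lie (q : ℂ[T;T⁻¹]) (n : ℕ) (v : V) :
    divPow V (pos 1) (n + 2) ⁅neg q, v⁆ =
      ⁅neg q, divPow V (pos 1) (n + 2) v⁆ + ⁅cartan q, divPow V (pos 1) (n + 1) v⁆
        - ⁅pos q, divPow V (pos 1) n v⁆ := by
  refine divPow_add_two_lie ?_ ?_ (lie_pos_pos 1 q) n v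
  · rw [lie_pos_neg, one_mul]
  · rw [← lie_skew, lie_cartan_pos, mul_one]
    exact (neg_smul (2 : ℂ) (pos q)).symm

variable {Ω : V} {Λ : ℂ[T;T⁻¹] →ₗ[ℂ] ℂ}

namespace HasLoopWeight

lemma pos_lie_divPow_neg_one (h : HasLoopWeight Ω Λ) (p q : ℂ[T;T⁻¹]) :
    ⁅pos q, divPow V (neg p) 1 Ω⁆ = Λ (p * q) • Ω := by
  rw [divPow_one, pos_neg_lie, h.pos_lie, lie_zero, add_zero, h.cartan_lie, mul_comm]

lemma pos_lie_divPow_neg (h : HasLoopWeight Ω Λ) (p q : ℂ[T;T⁻¹]) (n : ℕ) :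
    ⁅pos q, divPow V (neg p) (n + 2) Ω⁆ =
      Λ (p * q) • divPow V (neg p) (n + 1) Ω - ⁅neg (p * (p * q)), divPow V (neg p) n Ω⁆ := by
  have lie_neg_pos : ⁅neg p, pos q⁆ = cartan (-(p * q)) := by
    rw [← lie_skew, lie_pos_neg, mul_comm, map_neg]
  have lie_neg_cartan (b : ℂ[T;T⁻¹]) : ⁅neg p, cartan b⁆ = neg ((2 : ℂ) • (p * b)) := by
    rw [← lie_skew, lie_cartan_neg, mul_comm b, ← map_smul, ← map_neg, ← neg_smul, neg_neg]
  have pos_right := divPow_add_two_lie (V := V) lie_neg_pos (w := neg (p * (p * q)))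
    (by rw [lie_neg_cartan, ← map_smul, mul_neg, smul_neg, neg_smul]) (lie_neg_neg _ _) n Ω
  have cartan_right := divPow_succ_lie (V := V) (lie_neg_cartan (p * q)) (lie_neg_neg _ _) n Ω
  rw [h.pos_lie, map_zero, map_neg cartan, neg_lie] at pos_right
  rw [h.cartan_lie, map_smul, map_smul neg, loop_smul_lie] at cartan_right
  linear_combination (norm := module) -cartan_right - pos_right

lemma divPow_pos_succ_eq_zero (h : HasLoopWeight Ω Λ) {q : ℂ[T;T⁻¹]} {n : ℕ} {v : V} {c : ℂ}
    (hv : divPow V (pos q) n v = c • Ω) : divPow V (pos q) (n + 1) v = 0 := by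
  have key := lie_divPow (pos q) n v
  rw [hv, lie_smul, h.pos_lie, smul_zero] at key
  exact (smul_eq_zero_iff_right (Nat.cast_add_one_ne_zero n)).1 key.symm

lemma divPow_pos_one_neg_lie_divPow_neg (h : HasLoopWeight Ω Λ) {p : ℂ[T;T⁻¹]} {lam : ℕ → ℂ}
    {n : ℕ} (hlam : ∀ k ≤ n, divPow V (pos 1) k (divPow V (neg p) k Ω) = lam k • Ω)
    (q : ℂ[T;T⁻¹]) :
    divPow V (pos 1) (n + 1) ⁅neg q, divPow V (neg p) n Ω⁆ =
      (∑ j ∈ Finset.range (n + 1), (-1) ^ j * Λ (p ^ j * q) * lam (n - j)) • Ω := by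
  have lam_zero : lam 0 = 1 := by
    refine smul_left_injective ℂ h.ne_zero ?_
    simpa only [divPow_zero, one_smul] using (hlam 0 n.zero_le).symm
  induction n using Nat.twoStepInduction generalizing q with
  | zero => simp [divPow_zero, divPow_one, pos_neg_lie, h.cartan_lie, h.pos_lie, lam_zero]
  | one =>
    rw [divPow_pos_one_neg_lie, h.divPow_pos_succ_eq_zero (hlam 1 le_rfl), hlam 1 le_rfl,
      divPow_zero, h.pos_lie_divPow_neg_one, lie_zero, lie_smul, h.cartan_lie]
    simp only [Finset.sum_range_succ, Finset.sum_range_zero, lam_zero, pow_zero, pow_one, one_mul,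
      Nat.sub_zero, Nat.sub_self]
    module
  | more n ih _ =>
    rw [divPow_pos_one_neg_lie, h.divPow_pos_succ_eq_zero (hlam _ le_rfl), hlam _ le_rfl,
      ← divPow_lie_of_commute (lie_pos_pos 1 q), h.pos_lie_divPow_neg, map_sub, map_smul,
      hlam (n + 1) (Nat.le_succ _), ih (fun k hk => hlam k (by omega)), lie_zero, lie_smul,
      h.cartan_lie, Finset.sum_range_succ' _ (n + 2), Finset.sum_range_succ' _ (n + 1)]
    have shift (j : ℕ) : p ^ (j + 1 + 1) * q = p ^ j * (p * (p * q)) := by ring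
    simp only [shift, Nat.add_sub_add_right, pow_succ (-1 : ℂ), pow_one, pow_zero, mul_neg,
      mul_one, neg_neg, one_mul, zero_add, Nat.sub_zero, Nat.add_succ_sub_one]
    module

lemma add_one_smul_divPow_pos_divPow_neg (h : HasLoopWeight Ω Λ) {p : ℂ[T;T⁻¹]} {lam : ℕ → ℂ}
    {n : ℕ} (hlam : ∀ k ≤ n, divPow V (pos 1) k (divPow V (neg p) k Ω) = lam k • Ω) :
    ((n : ℂ) + 1) • divPow V (pos 1) (n + 1) (divPow V (neg p) (n + 1) Ω) =
      (∑ j ∈ Finset.range (n + 1), (-1) ^ j * Λ (p ^ (j + 1)) * lam (n - j)) • Ω := by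
  simpa only [lie_divPow, map_smul, ← pow_succ] using h.divPow_pos_one_neg_lie_divPow_neg hlam p

lemma exists_divPow_eq_smul (h : HasLoopWeight Ω Λ) (p : ℂ[T;T⁻¹]) :
    ∃ lam : ℕ → ℂ, ∀ k, divPow V (pos 1) k (divPow V (neg p) k Ω) = lam k • Ω := by
  suffices ∀ k, ∃ c : ℂ, divPow V (pos 1) k (divPow V (neg p) k Ω) = c • Ω from
    Classical.skolem.1 this
  intro k
  induction k using Nat.strongRec with
  | ind k ih =>
    obtain _ | n := k
    · exact ⟨1, by rw [divPow_zero, divPow_zero, one_smul]⟩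
    · choose! lam hlam using ih
      have key := h.add_one_smul_divPow_pos_divPow_neg fun k hk => hlam k (Nat.lt_succ_of_le hk)
      exact ⟨_, ((eq_inv_smul_iff₀ (Nat.cast_add_one_ne_zero n)).2 key).trans (smul_smul _ _ _)⟩

/-- Newton's identities: the `Λ (p ^ j)` are to the `lam k` as power sums are to elementary
symmetric functions. -/
lemma add_one_mul_eq_sum (h : HasLoopWeight Ω Λ) {p : ℂ[T;T⁻¹]} {lam : ℕ → ℂ} {n : ℕ}
    (hlam : ∀ k ≤ n + 1, divPow V (pos 1) k (divPow V (neg p) k Ω) = lam k • Ω) :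
    ((n : ℂ) + 1) * lam (n + 1) =
      ∑ j ∈ Finset.range (n + 1), (-1) ^ j * Λ (p ^ (j + 1)) * lam (n - j) := by
  refine smul_left_injective ℂ h.ne_zero ?_
  simp only
  rw [mul_smul, ← hlam _ le_rfl]
  exact h.add_one_smul_divPow_pos_divPow_neg fun k hk => hlam k (hk.trans (Nat.le_succ n))

end HasLoopWeight

end DividedPowers

section DrinfeldPolynomial

variable {V : Type*} [AddCommGroup V] [Module ℂ V] [LieRingModule L V] [LieModule ℂ L V]
  {Ω : V} {Λ : ℂ[T;T⁻¹] →ₗ[ℂ] ℂ}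

lemma divPow_eq_zero_iff {x : L} {n : ℕ} {v : V} :
    divPow V x n v = 0 ↔ (toEnd ℂ L V x ^ n) v = 0 :=
  smul_eq_zero_iff_right (inv_ne_zero (Nat.cast_ne_zero.2 n.factorial_ne_zero))

lemma pow_toEnd_neg_apply (p : ℂ[T;T⁻¹]) (n : ℕ) :
    (toEnd ℂ L V (neg p) ^ n) Ω = lowered Ω (List.replicate n p) := by
  induction n with
  | zero => rfl
  | succ n ih => rw [pow_succ', Module.End.mul_apply, ih]; rfl

namespace HasLoopWeight

attribute [local instance] LieRing.ofAssociativeRing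

lemma pow_toEnd_pos_one_ne_zero [FiniteDimensional ℂ (generatedRep Ω)] (h : HasLoopWeight Ω Λ)
    {r : ℕ} (hr : Λ 1 = r) {v : V} (hv_mem : v ∈ generatedRep Ω) (hv : v ≠ 0)
    (hweight : ⁅cartan 1, v⁆ = (-r : ℂ) • v) : (toEnd ℂ L V (pos 1) ^ r) v ≠ 0 := by
  obtain rfl | hr_ne := eq_or_ne r 0
  · exact hv
  have cartan_ne_zero : toEnd ℂ L (generatedRep Ω) (cartan (1 * 1)) ≠ 0 := by
    intro hzero
    have hΩ : ⁅cartan (1 * 1), Ω⁆ = 0 :=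
      congrArg Subtype.val (LinearMap.congr_fun hzero ⟨Ω, mem_generatedRep Ω⟩)
    rw [h.cartan_lie, one_mul, hr, smul_eq_zero_iff_left h.ne_zero, Nat.cast_eq_zero] at hΩ
    exact hr_ne hΩ
  have triple := h.isSl2Triple_toEnd (p := 1) (q := 1) (by simp) (by simp) cartan_ne_zero
  have key := pow_toEnd_e_ne_zero triple (K := ℂ) (M := generatedRep Ω) (r := r)
    (v := ⟨v, hv_mem⟩) ?_ (fun hzero => hv (congrArg Subtype.val hzero)) ?_
  · rw [LieModule.toEnd_module_end, LieHom.id_apply, Ne, ← ZeroMemClass.coe_eq_zero,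
      LieSubmodule.coe_toEnd_pow] at key
    exact key
  · intro n hn
    rw [LieModule.toEnd_module_end, LieHom.id_apply, one_mul] at hn
    obtain ⟨m, hm⟩ := h.exists_eq_of_hasEigenvalue hn
    rw [hr] at hm
    have : (n + m : ℂ) = 0 := by linear_combination hm / 2
    exact (Nat.add_eq_zero_iff.1 (mod_cast this : n + m = 0)).1
  · rw [one_mul]
    exact Subtype.ext hweight

variable [FiniteDimensional ℂ (generatedRep Ω)]

lemma exists_nat_apply_one (h : HasLoopWeight Ω Λ) : ∃ r : ℕ, Λ 1 = r ∧
    divPow V (neg (T 1)) r Ω ≠ 0 ∧ ∀ k > r, divPow V (neg (T 1)) k Ω = 0 := by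
  have mul_eq_one : (T 1 * T (-1) : ℂ[T;T⁻¹]) = 1 := by
    rw [← T_add, add_neg_cancel, T_zero]
  obtain ⟨r, hr, ne_zero, eq_zero⟩ := h.exists_nat_pow_neg (p := T 1) (q := T (-1))
    (by simp [mul_eq_one]) (by simp [mul_eq_one])
  refine ⟨r, mul_eq_one ▸ hr, divPow_eq_zero_iff.not.2 ne_zero, fun k hk => ?_⟩
  obtain ⟨m, rfl⟩ := Nat.exists_eq_add_of_le' hk
  rw [divPow_eq_zero_iff, pow_add, Module.End.mul_apply, eq_zero, map_zero]

lemma divPow_neg_eq_zero (h : HasLoopWeight Ω Λ) {r k : ℕ} (hr : Λ 1 = r) (hk : r < k) :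
    divPow V (neg (T 1)) k Ω = 0 := by
  obtain ⟨r', hr', -, eq_zero⟩ := h.exists_nat_apply_one
  exact eq_zero k (Nat.cast_injective (hr'.symm.trans hr) ▸ hk)

lemma divPow_pos_divPow_neg_ne_zero (h : HasLoopWeight Ω Λ) {r : ℕ} (hr : Λ 1 = r) :
    divPow V (pos 1) r (divPow V (neg (T 1)) r Ω) ≠ 0 := by
  obtain ⟨r', hr', ne_zero, -⟩ := h.exists_nat_apply_one
  obtain rfl : r = r' := Nat.cast_injective (hr.symm.trans hr')
  have hv : divPow V (neg (T 1)) r Ω = (r.factorial : ℂ)⁻¹ • lowered Ω (List.replicate r (T 1)) :=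
    congrArg _ (pow_toEnd_neg_apply _ _)
  refine divPow_eq_zero_iff.not.2 (h.pow_toEnd_pos_one_ne_zero hr ?_ ne_zero ?_)
  · exact hv ▸ (generatedRep Ω).smul_mem _ (lowered_mem_generatedRep _)
  · rw [hv, lie_smul, h.cartan_one_lie_lowered, List.length_replicate, hr]
    module

end HasLoopWeight

open Polynomial in
lemma HasLoopWeight.drinfeldPolynomial_coeff [FiniteDimensional ℂ (generatedRep Ω)]
    (h : HasLoopWeight Ω Λ) {r : ℕ} (hr : Λ 1 = r) {lam : ℕ → ℂ}
    (hlam : ∀ k, divPow V (pos 1) k (divPow V (neg (T 1)) k Ω) = lam k • Ω)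
    {P : ℂ[X]} (hP : IsDrinfeldPolynomial Ω r P) (n : ℕ) : P.coeff n = (-1) ^ n * lam n := by
  obtain ⟨lam', hlam', rfl⟩ := hP
  rw [coeff_sum_C_mul_neg_X_pow]
  split_ifs with hn
  · congr 1
    exact smul_left_injective ℂ h.ne_zero ((hlam' n hn).symm.trans (hlam n))
  · have lam_eq_zero : lam n • Ω = 0 := by
      rw [← hlam, h.divPow_neg_eq_zero hr (not_le.1 hn), map_zero]
    rw [(smul_eq_zero_iff_left h.ne_zero).1 lam_eq_zero, mul_zero]

open Polynomial in
lemma HasLoopWeight.natDegree_drinfeldPolynomial [FiniteDimensional ℂ (generatedRep Ω)]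
    (h : HasLoopWeight Ω Λ) {r : ℕ} (hr : Λ 1 = r) {P : ℂ[X]} (hP : IsDrinfeldPolynomial Ω r P) :
    P.natDegree = r := by
  obtain ⟨lam, hlam⟩ := h.exists_divPow_eq_smul (T 1)
  have coeff_eq := h.drinfeldPolynomial_coeff hr hlam hP
  refine natDegree_eq_of_le_of_coeff_ne_zero (natDegree_le_iff_coeff_eq_zero.2 fun n hn => ?_) ?_
  · have lam_eq_zero : lam n • Ω = 0 := by
      rw [← hlam, h.divPow_neg_eq_zero hr hn, map_zero]
    rw [coeff_eq, (smul_eq_zero_iff_left h.ne_zero).1 lam_eq_zero, mul_zero]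
  · rw [coeff_eq]
    refine mul_ne_zero (pow_ne_zero r (neg_ne_zero.2 one_ne_zero)) fun lam_eq_zero => ?_
    exact h.divPow_pos_divPow_neg_ne_zero hr (by rw [hlam, lam_eq_zero, zero_smul])

end DrinfeldPolynomial

section Idempotents

variable {V : Type*} [AddCommGroup V] [Module ℂ V] [LieRingModule L V] [LieModule ℂ L V]
  {Ω : V} {Λ : ℂ[T;T⁻¹] →ₗ[ℂ] ℂ} {p : ℂ[T;T⁻¹]}

namespace HasLoopWeight

variable [FiniteDimensional ℂ (generatedRep Ω)]

lemma exists_nat_pow_neg_of_idempotent (h : HasLoopWeight Ω Λ)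
    (hp : p * p - p ∈ h.annihilator) :
    ∃ n : ℕ, Λ p = n ∧ (toEnd ℂ L V (neg p) ^ (n + 1)) Ω = 0 := by
  have hp' : p * p * p - p ∈ h.annihilator := by
    convert! h.annihilator.mul_mem_left (p + 1) hp using 1
    ring
  obtain ⟨n, hn, -, eq_zero⟩ := h.exists_nat_pow_neg hp' hp'
  refine ⟨n, ?_, eq_zero⟩
  rw [← hn, ← sub_eq_zero, ← neg_sub, ← map_sub, h.apply_eq_zero_of_mem_annihilator hp, neg_zero]

lemma mem_annihilator_of_idempotent (h : HasLoopWeight Ω Λ) (hp : p * p - p ∈ h.annihilator)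
    (hΛ : Λ p = 0) : p ∈ h.annihilator := by
  obtain ⟨n, hn, eq_zero⟩ := h.exists_nat_pow_neg_of_idempotent hp
  obtain rfl : n = 0 := Nat.cast_eq_zero.1 (hn.symm.trans hΛ)
  exact h.mem_annihilator.2 eq_zero

lemma neg_lie_neg_lie_of_idempotent (h : HasLoopWeight Ω Λ) (hp : p * p - p ∈ h.annihilator)
    (hΛ : Λ p = 1) : ⁅neg p, ⁅neg p, Ω⁆⁆ = 0 := by
  obtain ⟨n, hn, eq_zero⟩ := h.exists_nat_pow_neg_of_idempotent hp
  obtain rfl : n = 1 := Nat.cast_eq_one.1 (hn.symm.trans hΛ)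
  exact eq_zero

lemma neg_mul_lie_of_idempotent (h : HasLoopWeight Ω Λ) (hp : p * p - p ∈ h.annihilator)
    (hΛ : Λ p = 1) (q : ℂ[T;T⁻¹]) : ⁅neg (q * p), Ω⁆ = Λ (q * p) • ⁅neg p, Ω⁆ := by
  have hqp : q * p * p - q * p ∈ h.annihilator := by
    convert! h.annihilator.mul_mem_left q hp using 1
    ring
  have key := pos_neg_lie q p ⁅neg p, Ω⁆
  rw [h.neg_lie_neg_lie_of_idempotent hp hΛ, lie_zero, cartan_neg_lie, pos_neg_lie, h.pos_lie,
    lie_zero, add_zero, h.cartan_lie, lie_smul, h.neg_lie_congr hqp (mem_generatedRep Ω)] at key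
  apply smul_right_injective V (two_ne_zero (α := ℂ))
  linear_combination (norm := module) key

end HasLoopWeight

end Idempotents

section Parameters

variable {V : Type*} [AddCommGroup V] [Module ℂ V] [LieRingModule L V] [LieModule ℂ L V]
  {Ω : V} {Λ : ℂ[T;T⁻¹] →ₗ[ℂ] ℂ} {ι : Type*} [Fintype ι] {a : ι → ℂ}

namespace HasLoopWeight

lemma apply_pow_eq_sum_pow (h : HasLoopWeight Ω Λ) {p : ℂ[T;T⁻¹]}
    (hesymm : ∀ k, divPow V (pos 1) k (divPow V (neg p) k Ω) =
      (Finset.univ.val.map a).esymm k • Ω) (n : ℕ) :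
    Λ (p ^ (n + 1)) = ∑ i, a i ^ (n + 1) := by
  induction n using Nat.strongRec with
  | ind n ih =>
    have key := (h.add_one_mul_eq_sum fun k _ => hesymm k).symm.trans (add_one_mul_esymm_eq_sum a n)
    rw [Finset.sum_range_succ, Finset.sum_range_succ, Nat.sub_self, Finset.sum_congr rfl
      fun j hj => by rw [ih j (Finset.mem_range.1 hj)], add_right_inj] at key
    have esymm_zero : (Finset.univ.val.map a).esymm 0 = 1 := by simp [Finset.esymm_map_val]
    rw [esymm_zero, mul_one, mul_one] at key
    exact mul_left_cancel₀ (pow_ne_zero n (neg_ne_zero.2 one_ne_zero)) key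

variable [FiniteDimensional ℂ (generatedRep Ω)]

open Polynomial in
lemma apply_toLaurent_eq_sum_eval (h : HasLoopWeight Ω Λ)
    {r : ℕ} (hr : Λ 1 = r) (ha : ∀ i, a i ≠ 0)
    (hP : IsDrinfeldPolynomial Ω r (∏ i, (1 - Polynomial.C (a i) * Polynomial.X))) (f : ℂ[X]) :
    Λ (toLaurent f) = ∑ i, f.eval (a i) := by
  have card_eq : Fintype.card ι = r :=
    (natDegree_prod_one_sub_C_mul_X ha).symm.trans (h.natDegree_drinfeldPolynomial hr hP)
  obtain ⟨lam, hlam⟩ := h.exists_divPow_eq_smul (T 1)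
  have lam_eq (k : ℕ) : lam k = (Finset.univ.val.map a).esymm k := by
    have key := h.drinfeldPolynomial_coeff hr hlam hP k
    rw [coeff_prod_one_sub_C_mul_X] at key
    exact (mul_left_cancel₀ (pow_ne_zero k (neg_ne_zero.2 one_ne_zero)) key).symm
  induction f using Polynomial.induction_on' with
  | add f g hf hg => simp only [map_add, hf, hg, eval_add, Finset.sum_add_distrib]
  | monomial n c =>
    have apply_T : Λ (T 1 ^ n) = ∑ i, a i ^ n := by
      cases n with
      | zero => simpa [card_eq] using hr
      | succ n => exact h.apply_pow_eq_sum_pow (fun k => lam_eq k ▸ hlam k) n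
    rw [← C_mul_X_pow_eq_monomial, toLaurent_C_mul_X_pow, ← LaurentPolynomial.smul_eq_C_mul,
      map_smul, ← mul_one (n : ℤ), ← T_pow, apply_T, Finset.smul_sum]
    simp only [eval_mul, eval_C, eval_pow, eval_X, smul_eq_mul]

open Polynomial in
lemma exists_dvd_iff_mem_annihilator (h : HasLoopWeight Ω Λ) :
    ∃ g : ℂ[X], g ≠ 0 ∧ ∀ f, g ∣ f ↔ toLaurent f ∈ h.annihilator := by
  obtain ⟨g, hg⟩ := (IsPrincipalIdealRing.principal (h.annihilator.comap toLaurent)).principal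
  have dvd_iff (f : ℂ[X]) : g ∣ f ↔ toLaurent f ∈ h.annihilator := by
    rw [← Ideal.mem_span_singleton, ← Ideal.submodule_span_eq, ← hg, Ideal.mem_comap]
  refine ⟨g, ?_, dvd_iff⟩
  rintro rfl
  let φ : ℂ[X] →ₗ[ℂ] generatedRep Ω :=
    (LinearMap.flip (toEnd ℂ L (generatedRep Ω) : L →ₗ[ℂ] Module.End ℂ (generatedRep Ω))
      ⟨Ω, mem_generatedRep Ω⟩) ∘ₗ neg ∘ₗ toLaurentAlg.toLinearMap
  have φ_injective : Function.Injective φ := (injective_iff_map_eq_zero φ).2 fun f hf =>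
    zero_dvd_iff.1 ((dvd_iff f).2 (congrArg Subtype.val hf))
  exact Polynomial.not_finite (Module.Finite.of_injective φ φ_injective)

end HasLoopWeight

/-- `Ω` is a highest weight vector whose evaluation parameters `a i` are simple: they are nonzero
and pairwise distinct, and `p ⊗ h` acts on `Ω` by `∑ i, p (a i)`. The sum is spelled out for
polynomials `p` only; these exhaust the Laurent polynomials modulo the annihilator. -/
structure HasSimpleParameters (Ω : V) (Λ : ℂ[T;T⁻¹] →ₗ[ℂ] ℂ) (a : ι → ℂ) : Prop
    extends HasLoopWeight Ω Λ where
  injective : Function.Injective a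
  parameter_ne_zero : ∀ i, a i ≠ 0
  apply_toLaurent : ∀ f : Polynomial ℂ, Λ (Polynomial.toLaurent f) = ∑ i, f.eval (a i)

namespace HasSimpleParameters

open Polynomial (toLaurent)

variable (H : HasSimpleParameters Ω Λ a)
include H

lemma eval_eq_zero_of_mem_annihilator {f : Polynomial ℂ} (hf : toLaurent f ∈ H.annihilator)
    (j : ι) : f.eval (a j) = 0 := by
  classical
  have key := H.apply_eq_zero_of_mem_annihilator (H.annihilator.mul_mem_right
    (toLaurent (Lagrange.nodal (Finset.univ.erase j) a)) hf)
  rw [← map_mul, H.apply_toLaurent, sum_eval_mul_nodal_erase] at key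
  exact (mul_eq_zero.1 key).resolve_right (eval_nodal_erase_self_ne_zero H.injective j)

variable [FiniteDimensional ℂ (generatedRep Ω)]

lemma mem_range_and_rootMultiplicity_le_one {g : Polynomial ℂ} (hg : g ≠ 0)
    (dvd_iff : ∀ f, g ∣ f ↔ toLaurent f ∈ H.annihilator) {b : ℂ} (hb : g.IsRoot b) :
    b ∈ Set.range a ∧ g.rootMultiplicity b ≤ 1 := by
  obtain ⟨p, hp, eval_b, eval_ne⟩ := exists_dvd_mul_self_sub_self hg hb
  have hp_mem : toLaurent p * toLaurent p - toLaurent p ∈ H.annihilator := by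
    rwa [← map_mul, ← map_sub, ← dvd_iff]
  have isRoot (i : ι) : g.IsRoot (a i) :=
    H.eval_eq_zero_of_mem_annihilator ((dvd_iff g).1 dvd_rfl) i
  obtain ⟨j, rfl⟩ : b ∈ Set.range a := by
    by_contra! hb_notMem
    have hΛ : Λ (toLaurent p) = 0 := by
      rw [H.apply_toLaurent]
      exact Finset.sum_eq_zero fun i _ => eval_ne _ (fun h => hb_notMem ⟨i, h⟩) (isRoot i)
    have hdvd := (dvd_iff p).2 (H.mem_annihilator_of_idempotent hp_mem hΛ)
    exact one_ne_zero (eval_b.symm.trans (hb.dvd hdvd))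
  refine ⟨⟨j, rfl⟩, ?_⟩
  have hΛ : Λ (toLaurent p) = 1 := by
    rw [H.apply_toLaurent, Fintype.sum_eq_single j, eval_b]
    exact fun i hij => eval_ne _ (H.injective.ne hij) (isRoot i)
  set ℓ : Polynomial ℂ := Polynomial.X - Polynomial.C (a j)
  have hdvd : g ∣ ℓ * p := by
    rw [dvd_iff, H.mem_annihilator, map_mul, H.neg_mul_lie_of_idempotent hp_mem hΛ, ← map_mul,
      H.apply_toLaurent, Finset.sum_eq_zero, zero_smul]
    intro i _
    obtain rfl | hij := eq_or_ne i j
    · simp [ℓ]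
    · rw [Polynomial.eval_mul, eval_ne _ (H.injective.ne hij) (isRoot i), mul_zero]
  have hp_root : ¬ p.IsRoot (a j) := by rw [Polynomial.IsRoot.def, eval_b]; exact one_ne_zero
  have hp_ne : p ≠ 0 := by rintro rfl; simp at eval_b
  have hne : ℓ * p ≠ 0 := mul_ne_zero (Polynomial.X_sub_C_ne_zero _) hp_ne
  calc g.rootMultiplicity (a j) ≤ (ℓ * p).rootMultiplicity (a j) :=
        Polynomial.rootMultiplicity_le_rootMultiplicity_of_dvd hne hdvd _
    _ = 1 := by
      rw [Polynomial.rootMultiplicity_mul hne, Polynomial.rootMultiplicity_X_sub_C_self,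
        Polynomial.rootMultiplicity_eq_zero hp_root]

lemma toLaurent_mem_annihilator_iff {f : Polynomial ℂ} :
    toLaurent f ∈ H.annihilator ↔ ∀ i, f.eval (a i) = 0 := by
  refine ⟨H.eval_eq_zero_of_mem_annihilator, fun hf => ?_⟩
  obtain ⟨g, hg, dvd_iff⟩ := H.exists_dvd_iff_mem_annihilator
  obtain rfl | hf_ne := eq_or_ne f 0
  · rw [map_zero]
    exact zero_mem _
  have root {b : ℂ} (hb : b ∈ g.roots) :=
    H.mem_range_and_rootMultiplicity_le_one hg dvd_iff (Polynomial.isRoot_of_mem_roots hb)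
  rw [← dvd_iff, IsAlgClosed.dvd_iff_roots_le_roots hg hf_ne, Multiset.le_iff_subset]
  · intro b hb
    obtain ⟨⟨i, rfl⟩, -⟩ := root hb
    exact (Polynomial.mem_roots hf_ne).2 (hf i)
  · rw [Multiset.nodup_iff_count_eq_one]
    intro b hb
    refine le_antisymm ?_ (Multiset.one_le_count_iff_mem.2 hb)
    rw [Polynomial.count_roots]
    exact (root hb).2

lemma toLaurent_sub_mem_annihilator {f g : Polynomial ℂ}
    (hfg : ∀ i, f.eval (a i) = g.eval (a i)) : toLaurent f - toLaurent g ∈ H.annihilator := by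
  rw [← map_sub, H.toLaurent_mem_annihilator_iff]
  exact fun i => by rw [Polynomial.eval_sub, hfg, sub_self]

lemma exists_sub_toLaurent_mem_annihilator (p : ℂ[T;T⁻¹]) :
    ∃ f : Polynomial ℂ, p - toLaurent f ∈ H.annihilator := by
  obtain ⟨n, f, hf⟩ := p.exists_T_pow
  have coprime : IsCoprime (Polynomial.X ^ n) (Lagrange.nodal Finset.univ a) :=
    (Polynomial.irreducible_X.coprime_iff_not_dvd.2 (by
      rw [Polynomial.X_dvd_iff, Polynomial.coeff_zero_eq_eval_zero]
      exact Lagrange.eval_nodal_not_at_node fun i _ => (H.parameter_ne_zero i).symm)).pow_left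
  obtain ⟨u, w, huw⟩ := coprime
  refine ⟨u * f, ?_⟩
  have nodal_mem : toLaurent (Lagrange.nodal Finset.univ a) ∈ H.annihilator :=
    H.toLaurent_mem_annihilator_iff.2 fun i => Lagrange.eval_nodal_at_node (Finset.mem_univ i)
  have huw' := congrArg toLaurent huw
  rw [map_add, map_mul, map_mul, map_pow, Polynomial.toLaurent_X, T_pow, mul_one, map_one] at huw'
  convert! H.annihilator.mul_mem_left (toLaurent w * p) nodal_mem using 1
  rw [map_mul, hf]
  linear_combination -p * huw'

end HasSimpleParameters

end Parameters

section Basis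

open Polynomial (toLaurent)

variable {ι : Type*} [Fintype ι] [DecidableEq ι] {a : ι → ℂ}

/-- The Laurent polynomial `∏_{i ≠ j} (t - a_i)`, for which `ρ_j(a) = cofactor a j ⊗ f`. -/
def cofactor (a : ι → ℂ) (j : ι) : ℂ[T;T⁻¹] :=
  toLaurent (Lagrange.nodal (Finset.univ.erase j) a)

lemma xNegParam_eq_neg (A : Multiset ℂ) :
    xNegParam A =
      neg (toLaurent (A.map fun c => Polynomial.X - Polynomial.C c).prod) := by
  rw [Multiset.prod_X_sub_X_eq_sum_esymm, map_sum, map_sum, xNegParam]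
  refine Finset.sum_congr rfl fun k hk => ?_
  have sign_eq : ((-1) ^ k : Polynomial ℂ) = Polynomial.C ((-1) ^ k) := by simp
  rw [sign_eq, ← mul_assoc, ← Polynomial.C_mul, Polynomial.toLaurent_C_mul_X_pow,
    ← LaurentPolynomial.smul_eq_C_mul, map_smul, neg_T,
    Nat.cast_sub (Nat.lt_succ_iff.1 (Finset.mem_range.1 hk))]

lemma rho_eq_neg_cofactor {s : ℕ} (a : Fin s → ℂ) (j : Fin s) : rho a j = neg (cofactor a j) := by
  rw [rho, xNegParam_eq_neg, Multiset.map_map]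
  rfl

lemma toLaurent_C_mul (c : ℂ) (f : Polynomial ℂ) :
    toLaurent (Polynomial.C c * f) = c • toLaurent f := by
  rw [map_mul, Polynomial.toLaurent_C, LaurentPolynomial.smul_eq_C_mul]

lemma smul_cofactor_eq_toLaurent_basis (j : ι) :
    Lagrange.nodalWeight Finset.univ a j • cofactor a j =
      toLaurent (Lagrange.basis Finset.univ a j) := by
  rw [Lagrange.basis_eq_prod_sub_inv_mul_nodal_div (Finset.mem_univ j),
    ← Lagrange.nodal_erase_eq_nodal_div (Finset.mem_univ j), toLaurent_C_mul, cofactor]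

variable {V : Type*} [AddCommGroup V] [LieRingModule L V] {Ω : V}

/-- The vector `ρ_{j₁}(a) ⋯ ρ_{jₙ}(a) Ω`, for a list `j₁, …, jₙ` of indices. -/
def rhoList (Ω : V) (a : ι → ℂ) (l : List ι) : V := lowered Ω (l.map (cofactor a))

lemma rhoList_cons (Ω : V) (a : ι → ℂ) (j : ι) (l : List ι) :
    rhoList Ω a (j :: l) = ⁅neg (cofactor a j), rhoList Ω a l⁆ := rfl

lemma rhoList_eq_of_perm {l l' : List ι} (hl : l.Perm l') : rhoList Ω a l = rhoList Ω a l' :=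
  lowered_eq_of_perm (hl.map _)

variable [Module ℂ V]

lemma rhoList_mem_generatedRep (l : List ι) : rhoList Ω a l ∈ generatedRep Ω :=
  lowered_mem_generatedRep _

variable [LieModule ℂ L V] {Λ : ℂ[T;T⁻¹] →ₗ[ℂ] ℂ}

lemma rhoVector_eq_rhoList (Ω : V) {s n : ℕ} (a : Fin s → ℂ) (j : Fin n → Fin s) :
    rhoVector Ω a j = rhoList Ω a (List.ofFn j) := by
  have prod_apply (l : List (Fin s)) :
      (l.map fun i => toEnd ℂ L V (rho a i)).prod Ω = rhoList Ω a l := by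
    induction l with
    | nil => rfl
    | cons i l ih =>
      rw [List.map_cons, List.prod_cons, Module.End.mul_apply, ih, LieModule.toEnd_apply_apply,
        rho_eq_neg_cofactor, rhoList_cons]
  rw [← prod_apply, List.map_ofFn]
  rfl

namespace HasSimpleParameters

variable [FiniteDimensional ℂ (generatedRep Ω)]

lemma mul_cofactor_sub_mem_annihilator (H : HasSimpleParameters Ω Λ a) (f : Polynomial ℂ) (j : ι) :
    toLaurent f * cofactor a j - f.eval (a j) • cofactor a j ∈ H.annihilator := by
  rw [cofactor, ← map_mul, ← toLaurent_C_mul]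
  refine H.toLaurent_sub_mem_annihilator fun i => ?_
  rw [Polynomial.eval_mul, Polynomial.eval_mul, Polynomial.eval_C]
  obtain rfl | hij := eq_or_ne i j
  · rfl
  · rw [eval_nodal_erase_of_ne hij, mul_zero, mul_zero]

lemma cofactor_mul_cofactor_mem_annihilator (H : HasSimpleParameters Ω Λ a) {i j : ι}
    (hij : i ≠ j) : cofactor a i * cofactor a j ∈ H.annihilator := by
  have key := H.mul_cofactor_sub_mem_annihilator (Lagrange.nodal (Finset.univ.erase i) a) j
  rwa [eval_nodal_erase_of_ne hij.symm, zero_smul, sub_zero] at key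

lemma exists_sub_sum_smul_cofactor_mem_annihilator (H : HasSimpleParameters Ω Λ a)
    (p : ℂ[T;T⁻¹]) : ∃ c : ι → ℂ, p - ∑ j, c j • cofactor a j ∈ H.annihilator := by
  obtain ⟨f, hf⟩ := H.exists_sub_toLaurent_mem_annihilator p
  have interpolate_eq : toLaurent (Lagrange.interpolate Finset.univ a fun i => f.eval (a i)) =
      ∑ j, (f.eval (a j) * Lagrange.nodalWeight Finset.univ a j) • cofactor a j := by
    simp only [Lagrange.interpolate_apply, map_sum, toLaurent_C_mul, mul_smul,
      smul_cofactor_eq_toLaurent_basis]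
  refine ⟨fun j => f.eval (a j) * Lagrange.nodalWeight Finset.univ a j, ?_⟩
  rw [← interpolate_eq, ← sub_add_sub_cancel p (toLaurent f)]
  refine add_mem hf (H.toLaurent_sub_mem_annihilator fun i => ?_)
  rw [Lagrange.eval_interpolate_at_node _ H.injective.injOn (Finset.mem_univ i)]

lemma cartan_lie_rhoList (H : HasSimpleParameters Ω Λ a) (f : Polynomial ℂ) (l : List ι) :
    ⁅cartan (toLaurent f), rhoList Ω a l⁆ =
      (∑ i, f.eval (a i) - 2 * (l.map fun j => f.eval (a j)).sum) • rhoList Ω a l := by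
  induction l with
  | nil => simpa [rhoList, lowered, H.apply_toLaurent] using H.cartan_lie (toLaurent f)
  | cons j l ih =>
    rw [rhoList_cons, cartan_neg_lie, ih, lie_smul, List.map_cons, List.sum_cons,
      H.neg_lie_congr (H.mul_cofactor_sub_mem_annihilator f j) (rhoList_mem_generatedRep l),
      map_smul, loop_smul_lie]
    module

lemma neg_lie_rhoList_mem_span (H : HasSimpleParameters Ω Λ a) (p : ℂ[T;T⁻¹]) (l : List ι) :
    ⁅neg p, rhoList Ω a l⁆ ∈ Submodule.span ℂ (Set.range (rhoList Ω a)) := by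
  obtain ⟨c, hc⟩ := H.exists_sub_sum_smul_cofactor_mem_annihilator p
  rw [H.neg_lie_congr hc (rhoList_mem_generatedRep l), map_sum, sum_lie]
  refine Submodule.sum_mem _ fun j _ => ?_
  rw [map_smul, loop_smul_lie]
  exact Submodule.smul_mem _ _ (Submodule.subset_span ⟨j :: l, rfl⟩)

lemma generatedRep_eq_span_rhoList (H : HasSimpleParameters Ω Λ a) :
    (generatedRep Ω).toSubmodule = Submodule.span ℂ (Set.range (rhoList Ω a)) := by
  refine le_antisymm (H.generatedRep_le (Submodule.subset_span ⟨[], rfl⟩) fun p v hv => ?_) ?_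
  · have map_le : (Submodule.span ℂ (Set.range (rhoList Ω a))).map (toEnd ℂ L V (neg p)) ≤
        Submodule.span ℂ (Set.range (rhoList Ω a)) := by
      rw [Submodule.map_span_le]
      rintro _ ⟨l, rfl⟩
      exact H.neg_lie_rhoList_mem_span p l
    exact map_le (Submodule.mem_map_of_mem hv)
  · rw [Submodule.span_le]
    rintro _ ⟨l, rfl⟩
    exact rhoList_mem_generatedRep l

lemma rhoList_pair_eq_zero (H : HasSimpleParameters Ω Λ a) (j : ι) : rhoList Ω a [j, j] = 0 := by
  set ε := toLaurent (Lagrange.basis Finset.univ a j) with hε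
  have eval_self : (Lagrange.basis Finset.univ a j).eval (a j) = 1 :=
    Lagrange.eval_basis_self H.injective.injOn (Finset.mem_univ j)
  have eval_of_ne {i : ι} (hij : i ≠ j) : (Lagrange.basis Finset.univ a j).eval (a i) = 0 :=
    Lagrange.eval_basis_of_ne hij.symm (Finset.mem_univ i)
  have idempotent : ε * ε - ε ∈ H.annihilator := by
    rw [hε, ← map_mul]
    refine H.toLaurent_sub_mem_annihilator fun i => ?_
    obtain rfl | hij := eq_or_ne i j
    · rw [Polynomial.eval_mul, eval_self, mul_one]
    · rw [Polynomial.eval_mul, eval_of_ne hij, mul_zero]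
  have hΛ : Λ ε = 1 := by
    rw [H.apply_toLaurent, Fintype.sum_eq_single j fun i => eval_of_ne, eval_self]
  have key := H.neg_lie_neg_lie_of_idempotent idempotent hΛ
  have weight_ne_zero := Lagrange.nodalWeight_ne_zero H.injective.injOn (Finset.mem_univ j)
  rw [hε, ← smul_cofactor_eq_toLaurent_basis, map_smul, loop_smul_lie, loop_smul_lie, lie_smul,
    smul_eq_zero_iff_right weight_ne_zero, smul_eq_zero_iff_right weight_ne_zero] at key
  exact key

lemma rhoList_eq_zero (H : HasSimpleParameters Ω Λ a) {l : List ι} (hl : ¬ l.Nodup) :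
    rhoList Ω a l = 0 := by
  obtain ⟨j, hj⟩ : ∃ j, [j, j].Sublist l := by
    simpa only [List.nodup_iff_sublist, not_forall, not_not] using hl
  obtain ⟨l', hl'⟩ := hj.exists_perm_append
  rw [rhoList_eq_of_perm (hl'.trans List.perm_append_comm)]
  clear hl'
  induction l' with
  | nil => exact H.rhoList_pair_eq_zero j
  | cons i l' ih => rw [List.cons_append, rhoList_cons, ih, lie_zero]

lemma pos_cofactor_lie_rhoList_of_notMem (H : HasSimpleParameters Ω Λ a) {j : ι} {l : List ι}
    (hj : j ∉ l) : ⁅pos (cofactor a j), rhoList Ω a l⁆ = 0 := by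
  induction l with
  | nil => exact H.pos_lie _
  | cons i l ih =>
    obtain ⟨hji, hjl⟩ := not_or.1 (List.mem_cons.not.1 hj)
    rw [rhoList_cons, pos_neg_lie, ih hjl, lie_zero, add_zero]
    exact H.cartan_lie_eq_zero (H.cofactor_mul_cofactor_mem_annihilator hji)
      (rhoList_mem_generatedRep l)

lemma pos_cofactor_lie_rhoList_cons (H : HasSimpleParameters Ω Λ a) {j : ι} {l : List ι}
    (hj : j ∉ l) : ⁅pos (cofactor a j), rhoList Ω a (j :: l)⁆ =
      ((Lagrange.nodal (Finset.univ.erase j) a).eval (a j) ^ 2) • rhoList Ω a l := by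
  have sum_eq_zero : (l.map fun i => (Lagrange.nodal (Finset.univ.erase j) a *
      Lagrange.nodal (Finset.univ.erase j) a).eval (a i)).sum = 0 := by
    refine List.sum_eq_zero fun x hx => ?_
    obtain ⟨i, hi, rfl⟩ := List.mem_map.1 hx
    rw [Polynomial.eval_mul, eval_nodal_erase_of_ne (ne_of_mem_of_not_mem hi hj), mul_zero]
  rw [rhoList_cons, pos_neg_lie, H.pos_cofactor_lie_rhoList_of_notMem hj, lie_zero, add_zero,
    cofactor, ← map_mul, H.cartan_lie_rhoList, sum_eq_zero, mul_zero, sub_zero,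
    sum_eval_mul_nodal_erase, sq]

lemma rhoList_ne_zero (H : HasSimpleParameters Ω Λ a) {l : List ι} (hl : l.Nodup) :
    rhoList Ω a l ≠ 0 := by
  induction l with
  | nil => exact H.ne_zero
  | cons j l ih =>
    obtain ⟨hj, hl⟩ := List.nodup_cons.1 hl
    intro hzero
    have key := H.pos_cofactor_lie_rhoList_cons hj
    rw [hzero, lie_zero, eq_comm, smul_eq_zero_iff_right
      (pow_ne_zero 2 (eval_nodal_erase_self_ne_zero H.injective j))] at key
    exact ih hl key

end HasSimpleParameters

end Basis

section OrderedBasis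

open Polynomial (toLaurent)

variable {V : Type*} [AddCommGroup V] [LieRingModule L V] [Module ℂ V] [LieModule ℂ L V]
  {Ω : V} {Λ : ℂ[T;T⁻¹] →ₗ[ℂ] ℂ} {s : ℕ} {a : Fin s → ℂ}

lemma sum_two_pow_injective_of_strictMono (s n : ℕ) :
    Function.Injective fun j : {j : Fin n → Fin s // StrictMono j} =>
      ∑ t, 2 ^ (j.1 t : ℕ) := by
  intro i j hij
  have sum_image (k : {k : Fin n → Fin s // StrictMono k}) :
      ∑ t, 2 ^ (k.1 t : ℕ) = ∑ x ∈ Finset.univ.image fun t => (k.1 t : ℕ), 2 ^ x :=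
    (Finset.sum_image fun t _ u _ h => k.2.injective (Fin.ext h)).symm
  simp only [sum_image] at hij
  have image_eq := congrArg (fun A : Finset ℕ => (A : Set ℕ))
    (Finset.geomSum_injective le_rfl hij)
  simp only [Finset.coe_image, Finset.coe_univ, Set.image_univ] at image_eq
  have val_eq := (StrictMono.range_inj (f := fun t => (i.1 t : ℕ)) (g := fun t => (j.1 t : ℕ))
    i.2 j.2).1 image_eq
  exact Subtype.ext (funext fun t => Fin.ext (congrFun val_eq t))

namespace HasSimpleParameters

variable [FiniteDimensional ℂ (generatedRep Ω)]

lemma linearIndependent_rhoList (H : HasSimpleParameters Ω Λ a) (n : ℕ) :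
    LinearIndependent ℂ fun j : {j : Fin n → Fin s // StrictMono j} =>
      rhoList Ω a (List.ofFn j.1) := by
  -- An operator `f ⊗ h` with `f (a i) = 2 ^ i` separates these vectors by its eigenvalues, since
  -- a set of indices is determined by its sum of powers of `2`.
  set f := Lagrange.interpolate Finset.univ a fun i => (2 : ℂ) ^ (i : ℕ)
  have eval_f (i : Fin s) : f.eval (a i) = 2 ^ (i : ℕ) :=
    Lagrange.eval_interpolate_at_node _ H.injective.injOn (Finset.mem_univ i)
  refine Module.End.eigenvectors_linearIndependent' (toEnd ℂ L V (cartan (toLaurent f)))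
    (fun j => ∑ i, f.eval (a i) - 2 * ((List.ofFn j.1).map fun i => f.eval (a i)).sum)
    (fun i j hij => ?_) _ fun j => ⟨Module.End.mem_eigenspace_iff.2 ?_, ?_⟩
  · simp only [eval_f, List.map_ofFn, List.sum_ofFn, Function.comp_apply, sub_right_inj,
      mul_right_inj' (two_ne_zero' ℂ)] at hij
    exact sum_two_pow_injective_of_strictMono s n (by exact_mod_cast hij)
  · exact H.cartan_lie_rhoList f (List.ofFn j.1)
  · exact H.rhoList_ne_zero (List.nodup_ofFn.2 j.2.injective)

lemma rhoList_mem_span_strictMono (H : HasSimpleParameters Ω Λ a) (l : List (Fin s)) :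
    rhoList Ω a l ∈ Submodule.span ℂ
      (Set.range fun j : {j : Fin l.length → Fin s // StrictMono j} =>
        rhoList Ω a (List.ofFn j.1)) := by
  by_cases hl : l.Nodup
  · have card_eq : l.toFinset.card = l.length := List.toFinset_card_of_nodup hl
    let j := l.toFinset.orderEmbOfFin card_eq
    refine Submodule.subset_span ⟨⟨j, j.strictMono⟩, rhoList_eq_of_perm ?_⟩
    refine List.perm_of_nodup_nodup_toFinset_eq (List.nodup_ofFn.2 j.injective) hl ?_
    ext x
    rw [List.mem_toFinset, List.mem_ofFn]
    exact Set.ext_iff.1 (Finset.range_orderEmbOfFin l.toFinset card_eq) x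
  · rw [H.rhoList_eq_zero hl]
    exact zero_mem _

lemma span_rhoList_eq_sector (H : HasSimpleParameters Ω Λ a) (n : ℕ) :
    Submodule.span ℂ (Set.range fun j : {j : Fin n → Fin s // StrictMono j} =>
      rhoList Ω a (List.ofFn j.1)) = sector Ω (Λ 1 - 2 * n) := by
  have cartan_lie (l : List (Fin s)) :
      toEnd ℂ L V (hCartan 0) (rhoList Ω a l) = (Λ 1 - 2 * l.length) • rhoList Ω a l := by
    have key := H.cartan_one_lie_lowered (l.map (cofactor a))
    rwa [List.length_map, ← T_zero, cartan_T] at key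
  rw [sector, H.generatedRep_eq_span_rhoList, span_range_inf_eigenspace _ cartan_lie]
  apply le_antisymm <;> rw [Submodule.span_le]
  · rintro _ ⟨j, rfl⟩
    refine Submodule.subset_span ⟨List.ofFn j.1, ?_, rfl⟩
    rw [Set.mem_ofPred_eq, List.length_ofFn]
  · rintro _ ⟨l, hl, rfl⟩
    obtain rfl : l.length = n := by simpa using hl
    exact H.rhoList_mem_span_strictMono l

end HasSimpleParameters

end OrderedBasis

end SlTwoLoop

end

open SlTwoLoop in
theorem mainTheorem2 {V : Type*} [AddCommGroup V] [Module ℂ V]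
    [LieRingModule SlTwoLoop.L V] [LieModule ℂ SlTwoLoop.L V]
    (Ω : V) (hΩ : IsHighestWeightVector Ω)
    (hfin : FiniteDimensional ℂ (generatedRep Ω)) :
    -- the weight `r` is a natural number and the Drinfeld polynomial exists, of degree `r`
    (∃ (r : ℕ) (P : Polynomial ℂ), ⁅hCartan 0, Ω⁆ = (r : ℂ) • Ω ∧
      IsDrinfeldPolynomial Ω r P ∧ P.natDegree = r) ∧
    ∀ (r : ℕ) (P : Polynomial ℂ), ⁅hCartan 0, Ω⁆ = (r : ℂ) • Ω → IsDrinfeldPolynomial Ω r P →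
      ∀ (s : ℕ) (a : Fin s → ℂ) (m : Fin s → ℕ), IsEvaluationParameters P a m →
        (∀ k, m k = 1) →
        ∀ n : ℕ,
          LinearIndependent ℂ
            (fun j : {j : Fin n → Fin s // StrictMono j} => rhoVector Ω a j.1) ∧
          Submodule.span ℂ
            (Set.range fun j : {j : Fin n → Fin s // StrictMono j} => rhoVector Ω a j.1) =
              sector Ω ((r : ℂ) - 2 * (n : ℂ)) ∧
          ∀ j : Fin n → Fin s, Monotone j → ¬ StrictMono j → rhoVector Ω a j = 0 := by
  obtain ⟨Λ, h⟩ := hΩ.exists_hasLoopWeight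
  have cartan_zero : ⁅hCartan 0, Ω⁆ = Λ 1 • Ω := h.cartan_lie 1
  constructor
  · obtain ⟨r, hr, -⟩ := h.exists_nat_apply_one
    obtain ⟨lam, hlam⟩ := h.exists_divPow_eq_smul (LaurentPolynomial.T 1)
    have hP : IsDrinfeldPolynomial Ω r
        (∑ k ∈ Finset.range (r + 1), Polynomial.C (lam k) * (-Polynomial.X) ^ k) :=
      ⟨lam, fun k _ => hlam k, rfl⟩
    exact ⟨r, _, hr ▸ cartan_zero, hP, h.natDegree_drinfeldPolynomial hr hP⟩
  · intro r P hr hP s a m ha hm n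
    replace hr : Λ 1 = r := smul_left_injective ℂ h.ne_zero (cartan_zero.symm.trans hr)
    have P_eq := ha.factorization
    simp only [hm, pow_one] at P_eq
    have H : HasSimpleParameters Ω Λ a :=
      ⟨h, ha.injective, ha.ne_zero, h.apply_toLaurent_eq_sum_eval hr ha.ne_zero (P_eq ▸ hP)⟩
    simp only [rhoVector_eq_rhoList]
    refine ⟨H.linearIndependent_rhoList n, hr ▸ H.span_rhoList_eq_sector n,
      fun j hj hj' => H.rhoList_eq_zero fun hl => ?_⟩
    exact hj' (hj.strictMono_of_injective (List.nodup_ofFn.1 hl))
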